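/- Let $G$ be a group, let $A,B$ be sets, and let $C\colon B\times A\to G$, $(b,a)\mapsto C_{ba}$, be a matrix that is normalized with respect to $a_0\in A$ and $b_0\in B$, i.e. $C_{b_0a}=1=C_{ba_0}$ for all $a\in A$, $b\in B$. Let $S=\mathcal M(G,A,B,C)$ be the Rees matrix semigroup, that is, the set $A\times G\times B$ with multiplication $(a,g,b)(a',g',b')=(a,gC_{ba'}g',b')$, and let $M=S^1$ be the monoid obtained from $S$ by adjoining a new identity. For a monoid $N$ put $H^n(N)=\operatorname{Ext}^n_{\mathbb ZN}(\mathbb Z,\mathbb Z)$, where $\mathbb Z$ is the trivial module, and put $H^n(S)=H^n(M)$. Write $H^{ab}=H/[H,H]$ for a group $H$, and let $G(M)$ be the group completion of $M$, i.e. the universal group receiving a homomorphism from $M$. Put $\overline A=A\setminus\{a_0\}$, $\overline B=B\setminus\{b_0\}$, and let $$\Psi\colon \operatorname{Hom}(G^{ab},\mathbb Z)\to\mathbb Z^{\overline A\times\overline B},\qquad \Psi(f)(a,b)=f(C_{ba}[G,G]).$$ Then: 1. $H^0(S)\cong\mathbb Z$. 2. $H^1(S)\cong\ker\Psi$, and $\ker\Psi=\operatorname{Hom}(G(M)^{ab},\mathbb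 Z)$, in the sense that restriction along the homomorphism $G\to G(M)$, $g\mapsto[(a_0,g,b_0)]$, maps $\operatorname{Hom}(G(M)^{ab},\mathbb Z)$ isomorphically onto $\ker\Psi\subseteq\operatorname{Hom}(G^{ab},\mathbb Z)$. 3. $H^n(S)\cong H^n(G)$ for all $n\ge 3$. 4. There is an exact sequence $0\to\operatorname{coker}\Psi\to H^2(S)\to H^2(G)\to 0$. In particular, if the subgroup $\langle C_{ba}[G,G]\mid (a,b)\in\overline A\times\overline B\rangle$ of $G^{ab}$ is finite, then $\Psi=0$, hence $H^1(S)\cong\operatorname{Hom}(G^{ab},\mathbb Z)$, and there is an exact sequence $0\to\mathbb Z^{\overline A\times\overline B}\to H^2(S)\to H^2(G)\to 0$. -/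

import Mathlib

universe u

/-- The Rees matrix semigroup `𝓜(G, A, B, C)` on the set `A × G × B`. -/
@[ext]
structure ReesMatrix {G A B : Type*} (C : B → A → G) where
  left : A
  mid : G
  right : B

/-- `(a, g, b) (a', g', b') = (a, g C_{b a'} g', b')`. -/
instance ReesMatrix.instSemigroup {G A B : Type*} [Group G] (C : B → A → G) :
    Semigroup (ReesMatrix C) where
  mul s t := ⟨s.left, s.mid * C s.right t.left * t.mid, t.right⟩
  mul_assoc s t r := by
    change ReesMatrix.mk _ _ _ = ReesMatrix.mk _ _ _
    simp only [HMul.hMul, ReesMatrix.mk.injEq, true_and, and_true]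
    change s.mid * C s.right t.left * t.mid * C t.right r.left * r.mid =
      s.mid * C s.right t.left * (t.mid * C t.right r.left * r.mid)
    simp only [mul_assoc]

theorem ReesMatrix.mul_def {G A B : Type*} [Group G] {C : B → A → G} (s t : ReesMatrix C) :
    s * t = ⟨s.left, s.mid * C s.right t.left * t.mid, t.right⟩ := rfl

/-- `C` is normalized with respect to `a₀` and `b₀`. -/
structure IsNormalizedMatrix {G A B : Type*} [Group G] (C : B → A → G) (a₀ : A) (b₀ : B) :
    Prop where
  row : ∀ a, C b₀ a = 1
  col : ∀ b, C b a₀ = 1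

/-- The trivial left `ℤM`-module `ℤ` (lifted to the universe of `M`). -/
noncomputable abbrev trivialIntModule (M : Type u) [Monoid M] :
    ModuleCat.{u} (MonoidAlgebra ℤ M) :=
  ModuleCat.of (MonoidAlgebra ℤ M) (Representation.trivial ℤ M (ULift.{u} ℤ)).asModule

/-- The cohomology `Hⁿ(M) = Extⁿ_{ℤM}(ℤ, ℤ)` of a monoid `M`. -/
noncomputable abbrev monoidCohomology (M : Type u) [Monoid M] (n : ℕ) : Type u :=
  CategoryTheory.Abelian.Ext (trivialIntModule M) (trivialIntModule M) n

/-- The cohomology `Hⁿ(S) = Hⁿ(S¹)` of a semigroup `S`, where `S¹` is `S` with a new identity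
adjoined. -/
noncomputable abbrev semigroupCohomology (S : Type u) [Semigroup S] (n : ℕ) : Type u :=
  monoidCohomology (WithOne S) n

/-- The group completion `G(M)` of a monoid `M`: the group generated by the elements of `M`
subject to the multiplication table of `M`. -/
abbrev GroupCompletion (M : Type*) [Monoid M] : Type _ :=
  PresentedGroup {r : FreeGroup M | ∃ x y : M,
    r = FreeGroup.of x * FreeGroup.of y * (FreeGroup.of (x * y))⁻¹}

theorem GroupCompletion.of_mul_of {M : Type*} [Monoid M] (x y : M) :
    (PresentedGroup.of (x * y) : GroupCompletion M) =
      PresentedGroup.of x * PresentedGroup.of y :=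
  (mul_inv_eq_one.mp (PresentedGroup.one_of_mem
    (rels := {r : FreeGroup M | ∃ x y : M,
      r = FreeGroup.of x * FreeGroup.of y * (FreeGroup.of (x * y))⁻¹}) ⟨x, y, rfl⟩)).symm

/-- The canonical homomorphism `M → G(M)`. -/
def GroupCompletion.ofHom (M : Type*) [Monoid M] : M →* GroupCompletion M where
  toFun := PresentedGroup.of
  map_mul' := GroupCompletion.of_mul_of
  map_one' := by simpa using GroupCompletion.of_mul_of (1 : M) 1

/-- `G(M)` is universal among groups receiving a homomorphism from `M`. -/
theorem GroupCompletion.existsUnique_lift {M H : Type*} [Monoid M] [Group H] (f : M →* H) :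
    ∃! F : GroupCompletion M →* H, F.comp (GroupCompletion.ofHom M) = f := by
  have h : ∀ r ∈ {r : FreeGroup M | ∃ x y : M,
      r = FreeGroup.of x * FreeGroup.of y * (FreeGroup.of (x * y))⁻¹},
      FreeGroup.lift f r = 1 := by
    rintro _ ⟨x, y, rfl⟩
    simp
  refine ⟨PresentedGroup.toGroup h, ?_, ?_⟩
  · ext x
    exact PresentedGroup.toGroup.of h
  · intro F hF
    ext x
    exact (DFunLike.congr_fun hF x).trans (PresentedGroup.toGroup.of h).symm

/-- For normalized `C` and `M = S¹`, the homomorphism `G → G(M)`, `g ↦ [(a₀, g, b₀)]`. -/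
def toGroupCompletion {G A B : Type*} [Group G] {C : B → A → G} {a₀ : A} {b₀ : B}
    (hC : IsNormalizedMatrix C a₀ b₀) : G →* GroupCompletion (WithOne (ReesMatrix C)) :=
  MonoidHom.mk'
    (fun g => GroupCompletion.ofHom _ ((⟨a₀, g, b₀⟩ : ReesMatrix C) : WithOne (ReesMatrix C)))
    (fun g h => by
      rw [← map_mul, ← WithOne.coe_mul, ReesMatrix.mul_def, hC.row, mul_one])

/-- The group `Hom(H^{ab}, ℤ)` for a group `H`. -/
abbrev HomAbInt (H : Type*) [Group H] : Type _ := Additive (Abelianization H) →+ ℤ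

/-- The restriction map `Hom(K^{ab}, ℤ) → Hom(H^{ab}, ℤ)` along a homomorphism `φ : H → K`. -/
def HomAbInt.restrict {H K : Type*} [Group H] [Group K] (φ : H →* K) :
    HomAbInt K →+ HomAbInt H where
  toFun f := f.comp (MonoidHom.toAdditive (Abelianization.map φ))
  map_zero' := rfl
  map_add' _ _ := rfl

/-- `Ψ : Hom(G^{ab}, ℤ) → ℤ^{Ā × B̄}`, `Ψ(f)(a, b) = f(C_{ba}[G, G])`, with `Ā = A \ {a₀}` and
`B̄ = B \ {b₀}`. -/
def reesPsi {G A B : Type*} [Group G] (C : B → A → G) (a₀ : A) (b₀ : B) :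
    HomAbInt G →+ ({a : A // a ≠ a₀} × {b : B // b ≠ b₀} → ℤ) where
  toFun f p := f (Additive.ofMul (Abelianization.of (C p.2 p.1)))
  map_zero' := rfl
  map_add' _ _ := rfl

/-! Everything happens at the idempotent `e = (a₀, 1, b₀)`. By normalization `g ↦ (a₀, g, b₀)`
identifies `G` with `eSe`, and `ℤMe` is a free right `ℤG`-module with basis indexed by `A`. The
functor `ℤMe ⊗ -` from `ℤG`-modules to `ℤM`-modules (here `Induced`) is therefore exact, preserves
projectives (`Induced.projective`) and is left adjoint to `N ↦ eN`. Since `eℤ = ℤ`, dimension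
shifting gives `Extⁿ(Induced X, ℤ) ≅ Extⁿ(X, ℤ)` for `n ≥ 1`, the left side over `ℤM` and the right
side over `ℤG` (`nonempty_ext_induced_equiv`).

For `X = ℤ` the induced module is `ℤA`, with every `(a, g, b)` sending all of `A` to `a`. The kernel
`K` of the augmentation `ℤA → ℤ` is free abelian on the differences `a - a₀`, and `S` acts on it as
zero. Covering `K` by the free `ℤM`-module on `Ā`, the relations are `Ā` copies of `ℤS`, that is, a
sum of copies of `ℤMe` indexed by `Ā × B`. So `K` has projective dimension at most one, and `Hom(K,
ℤ) = 0` because `S` acts as zero on `K` and trivially on `ℤ`. A map from the relations to `ℤ` is an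
arbitrary function on `Ā × B`, and it extends to the cover exactly when it does not depend on `B`.
Subtracting the value at `b₀` gives `Ext¹(K, ℤ) ≅ ℤ^{Ā × B̄}` (`extOneKernelEquiv`).

The long exact sequence of `0 → K → ℤA → ℤ → 0` now gives the isomorphisms for `n ≥ 3` and the exact
sequence `0 → H¹(S) → Hom(G^{ab}, ℤ) → ℤ^{Ā × B̄} → H²(S) → H²(G) → 0`. Its middle map is `Ψ`
(`extOneKernelEquiv_restrict`): lifting `K → ℤA` to presentations sends the relation indexed by `(a,
b)` to `C_{ba} - 1` in the copy of the augmentation ideal at `a₀`.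

The description of `ker Ψ` by `G(M)` is elementary: a homomorphism from `M` to an abelian group is
determined by its values on the `(a₀, g, b₀)`, and these values have to vanish on the entries of
`C`. -/

open CategoryTheory CategoryTheory.Abelian

/-! ### Linear maps over `ℤM` and the trivial module. -/

section MonoidAlgebraModules

theorem MonoidAlgebra.single_eq_zsmul {M : Type*} (m : M) (k : ℤ) :
    (MonoidAlgebra.single m k : MonoidAlgebra ℤ M) = k • MonoidAlgebra.single m 1 := by
  simp

theorem MonoidAlgebra.addHom_ext_single_one {M N : Type*} [AddGroup N]
    {f g : MonoidAlgebra ℤ M →+ N}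
    (h : ∀ m, f (MonoidAlgebra.single m 1) = g (MonoidAlgebra.single m 1)) : f = g := by
  refine DFunLike.ext _ _ fun x => ?_
  induction x using MonoidAlgebra.induction_linear with
  | zero => simp
  | add x y hx hy => rw [map_add, map_add, hx, hy]
  | single m k => rw [MonoidAlgebra.single_eq_zsmul, map_zsmul, map_zsmul, h]

variable {M V W : Type*} [Monoid M] [AddCommGroup V] [AddCommGroup W]
  [Module (MonoidAlgebra ℤ M) V] [Module (MonoidAlgebra ℤ M) W]

/-- An additive map commuting with the elements of `M` is `ℤM`-linear. -/
def MonoidAlgebra.linearMapOfSingle (f : V →+ W)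
    (h : ∀ (m : M) x, f (MonoidAlgebra.single m (1 : ℤ) • x) =
      MonoidAlgebra.single m (1 : ℤ) • f x) : V →ₗ[MonoidAlgebra ℤ M] W where
  toFun := f
  map_add' := map_add f
  map_smul' r x := by
    induction r using MonoidAlgebra.induction_linear with
    | zero => simp
    | add r s hr hs =>
      simp only [RingHom.id_apply] at hr hs ⊢
      rw [add_smul, add_smul, map_add, hr, hs]
    | single m k =>
      rw [MonoidAlgebra.single_eq_zsmul, RingHom.id_apply, smul_assoc, smul_assoc, map_zsmul, h]

@[simp]
theorem MonoidAlgebra.linearMapOfSingle_apply (f : V →+ W)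
    (h : ∀ (m : M) x, f (MonoidAlgebra.single m (1 : ℤ) • x) =
      MonoidAlgebra.single m (1 : ℤ) • f x) (x : V) :
    MonoidAlgebra.linearMapOfSingle f h x = f x := rfl

/-- The underlying group of the trivial module. -/
def trivialIntModuleEquiv (M : Type u) [Monoid M] : trivialIntModule M ≃+ ℤ :=
  (Representation.asModuleEquiv (Representation.trivial ℤ M (ULift.{u} ℤ))).toAddEquiv.trans
    AddEquiv.ulift

theorem single_smul_trivialIntModule {M : Type u} [Monoid M] (m : M) (x : trivialIntModule M) :
    (MonoidAlgebra.single m (1 : ℤ)) • x = x := by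
  exact (Representation.single_smul (Representation.trivial ℤ M (ULift.{u} ℤ)) (1 : ℤ) m x).trans
    (one_zsmul (ULift.up x.down))

/-- The endomorphisms of the trivial module are the multiplications by integers. -/
noncomputable def trivialIntModuleEnd (M : Type u) [Monoid M] :
    (trivialIntModule M →ₗ[MonoidAlgebra ℤ M] trivialIntModule M) ≃+ ℤ where
  toFun f := trivialIntModuleEquiv M (f ((trivialIntModuleEquiv M).symm 1))
  invFun k := MonoidAlgebra.linearMapOfSingle (zsmulAddGroupHom k) fun m x => by
    rw [single_smul_trivialIntModule, single_smul_trivialIntModule]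
  left_inv f := by
    ext x
    obtain ⟨k, rfl⟩ := (trivialIntModuleEquiv M).symm.surjective x
    have hk : (trivialIntModuleEquiv M).symm k = k • (trivialIntModuleEquiv M).symm 1 := by
      rw [← map_zsmul, smul_eq_mul, mul_one]
    apply (trivialIntModuleEquiv M).injective
    rw [MonoidAlgebra.linearMapOfSingle_apply, zsmulAddGroupHom_apply, hk, map_zsmul, map_zsmul,
      map_zsmul, map_zsmul, AddEquiv.apply_symm_apply, smul_eq_mul, smul_eq_mul, smul_eq_mul,
      mul_one, mul_comm]
  right_inv k := by
    change trivialIntModuleEquiv M (k • (trivialIntModuleEquiv M).symm 1) = k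
    rw [map_zsmul, AddEquiv.apply_symm_apply, smul_eq_mul, mul_one]
  map_add' f g := by rw [LinearMap.add_apply, map_add]

end MonoidAlgebraModules

/-! ### Short exact sequences of modules. -/

section ShortExactModules

variable {R : Type u} [Ring R] {X Y Z : Type u} [AddCommGroup X] [AddCommGroup Y] [AddCommGroup Z]
  [Module R X] [Module R Y] [Module R Z]

/-- The short complex of modules attached to an exact pair of linear maps. -/
abbrev ModuleCat.shortComplexOfExact (f : X →ₗ[R] Y) (g : Y →ₗ[R] Z) (h : Function.Exact f g) :
    ShortComplex (ModuleCat.{u} R) :=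
  ShortComplex.mk (ModuleCat.ofHom f) (ModuleCat.ofHom g) (by
    ext x
    exact h.apply_apply_eq_zero x)

theorem ModuleCat.shortExact_of_exact {f : X →ₗ[R] Y} {g : Y →ₗ[R] Z}
    (hf : Function.Injective f) (hg : Function.Surjective g) (h : Function.Exact f g) :
    (ModuleCat.shortComplexOfExact f g h).ShortExact where
  exact := (ShortComplex.ShortExact.moduleCat_exact_iff_function_exact _).mpr h
  mono_f := (ModuleCat.mono_iff_injective _).mpr hf
  epi_g := (ModuleCat.epi_iff_surjective _).mpr hg

/-- Exactness from an additive contracting homotopy. -/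
theorem Function.Exact.of_additive_splitting {X Y Z : Type*} [AddCommGroup X] [AddCommGroup Y]
    [AddCommGroup Z] {f : X →+ Y} {g : Y →+ Z} {κ : Y →+ X} {σ : Z →+ Y}
    (hgf : g.comp f = 0) (h : f.comp κ + σ.comp g = AddMonoidHom.id Y) : Function.Exact f g := by
  intro y
  constructor
  · intro hy
    refine ⟨κ y, ?_⟩
    simpa [hy] using DFunLike.congr_fun h y
  · rintro ⟨x, rfl⟩
    exact DFunLike.congr_fun hgf x

end ShortExactModules

/-! ### Dimension shifting and presentations of `Ext¹`. -/

section ExtShift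

universe w v

variable {𝒞 : Type v} [Category.{w} 𝒞] [Abelian 𝒞] [HasExt.{w} 𝒞]

/-- The two neighbouring terms of the long exact sequence, both `Ext` groups of the middle object,
vanish. -/
theorem CategoryTheory.ShortComplex.ShortExact.precomp_extClass_bijective {S : ShortComplex 𝒞}
    (hS : S.ShortExact) (Y : 𝒞) {n m : ℕ} (h : 1 + n = m)
    (h₀ : Subsingleton (Ext S.X₂ Y n)) (h₁ : Subsingleton (Ext S.X₂ Y m)) :
    Function.Bijective (hS.extClass.precomp Y h) := by
  constructor
  · rw [injective_iff_map_eq_zero]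
    intro x hx
    obtain ⟨y, rfl⟩ := Ext.contravariant_sequence_exact₁ hS Y x h hx
    rw [Subsingleton.elim y 0, Ext.comp_zero]
  · intro x
    exact Ext.contravariant_sequence_exact₃ hS Y x (Subsingleton.elim _ _) h

/-- Dimension shifting along `0 → X₁ → X₂ → X₃ → 0` with `X₂` projective. -/
noncomputable def CategoryTheory.ShortComplex.ShortExact.extShift {S : ShortComplex 𝒞}
    (hS : S.ShortExact) (Y : 𝒞) [Projective S.X₂] (n : ℕ) :
    Ext S.X₁ Y (n + 1) ≃+ Ext S.X₃ Y (n + 2) :=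
  AddEquiv.ofBijective (hS.extClass.precomp Y (by lia))
    (hS.precomp_extClass_bijective Y _ (Ext.subsingleton_of_projective _ _ _)
      (Ext.subsingleton_of_projective _ _ _))

/-- The connecting homomorphism `Hom(X₁, Y) → Ext¹(X₃, Y)`. -/
noncomputable def CategoryTheory.ShortComplex.ShortExact.homToExt {S : ShortComplex 𝒞}
    (hS : S.ShortExact) (Y : 𝒞) : (S.X₁ ⟶ Y) →+ Ext S.X₃ Y 1 :=
  (hS.extClass.precomp Y (add_zero 1)).comp Ext.addEquiv₀.symm.toAddMonoidHom

theorem CategoryTheory.ShortComplex.ShortExact.homToExt_apply {S : ShortComplex 𝒞}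
    (hS : S.ShortExact) {Y : 𝒞} (φ : S.X₁ ⟶ Y) :
    hS.homToExt Y φ = hS.extClass.comp (Ext.mk₀ φ) (add_zero 1) := rfl

theorem CategoryTheory.ShortComplex.ShortExact.homToExt_surjective {S : ShortComplex 𝒞}
    (hS : S.ShortExact) (Y : 𝒞) [Projective S.X₂] : Function.Surjective (hS.homToExt Y) := by
  intro x
  have := Ext.subsingleton_of_projective S.X₂ Y 0
  obtain ⟨y, hy⟩ := Ext.contravariant_sequence_exact₃ hS Y x (Subsingleton.elim _ _) (add_zero 1)
  refine ⟨Ext.addEquiv₀ y, ?_⟩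
  rw [hS.homToExt_apply, Ext.mk₀_addEquiv₀_apply, hy]

/-- Together with surjectivity for projective `X₂`, this presents `Ext¹(X₃, Y)` as `Hom(X₁, Y)`
modulo restrictions from `X₂`. Every `Ext¹` below is computed in this form. -/
theorem CategoryTheory.ShortComplex.ShortExact.homToExt_eq_zero_iff {S : ShortComplex 𝒞}
    (hS : S.ShortExact) {Y : 𝒞} (φ : S.X₁ ⟶ Y) :
    hS.homToExt Y φ = 0 ↔ ∃ ψ : S.X₂ ⟶ Y, S.f ≫ ψ = φ := by
  rw [hS.homToExt_apply]
  constructor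
  · intro h
    obtain ⟨y, hy⟩ := Ext.contravariant_sequence_exact₁ hS Y _ (add_zero 1) h
    refine ⟨Ext.addEquiv₀ y, Ext.addEquiv₀.symm.injective ?_⟩
    change Ext.mk₀ _ = Ext.mk₀ _
    rw [← hy, ← Ext.mk₀_comp_mk₀, Ext.mk₀_addEquiv₀_apply]
  · rintro ⟨ψ, rfl⟩
    rw [← Ext.mk₀_comp_mk₀, hS.extClass_comp_assoc]

/-- Extension classes are natural in the sequence. This lets a map on `Ext¹` be computed on
presentations, which is how `Ψ` is recognized. -/
theorem CategoryTheory.ShortComplex.ShortExact.homToExt_naturality {S T : ShortComplex 𝒞}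
    (hS : S.ShortExact) (hT : T.ShortExact) (f : S ⟶ T) {Y : 𝒞} (φ : T.X₁ ⟶ Y) :
    hS.homToExt Y (f.τ₁ ≫ φ) = (Ext.mk₀ f.τ₃).comp (hT.homToExt Y φ) (zero_add 1) := by
  rw [homToExt_apply, homToExt_apply, ← Ext.mk₀_comp_mk₀,
    ← Ext.comp_assoc _ _ _ (add_zero 1) (zero_add 0) (by lia), hS.extClass_naturality hT f,
    Ext.comp_assoc _ _ _ (zero_add 1) (add_zero 1) (by lia)]

end ExtShift

/-- Surjections out of the same group with the same kernel have isomorphic targets. -/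
noncomputable def AddMonoidHom.equivOfSurjectiveOfKer {H K E F : Type*} [AddCommGroup H]
    [AddCommGroup K] [AddCommGroup E] [AddCommGroup F] (p : H →+ E) (q : K →+ F)
    (hp : Function.Surjective p) (hq : Function.Surjective q) (e : H ≃+ K)
    (h : ∀ x, p x = 0 ↔ q (e x) = 0) : E ≃+ F :=
  (QuotientAddGroup.quotientKerEquivOfSurjective p hp).symm.trans <|
    (QuotientAddGroup.congr p.ker q.ker e (by
      ext y
      constructor
      · rintro ⟨x, hx, rfl⟩
        exact (h x).mp hx
      · intro hy
        exact ⟨e.symm y, (h _).mpr (by simpa using hy), by simp⟩)).trans <|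
      QuotientAddGroup.quotientKerEquivOfSurjective q hq

theorem AddMonoidHom.equivOfSurjectiveOfKer_apply {H K E F : Type*} [AddCommGroup H]
    [AddCommGroup K] [AddCommGroup E] [AddCommGroup F] (p : H →+ E) (q : K →+ F)
    (hp : Function.Surjective p) (hq : Function.Surjective q) (e : H ≃+ K)
    (h : ∀ x, p x = 0 ↔ q (e x) = 0) (x : H) :
    AddMonoidHom.equivOfSurjectiveOfKer p q hp hq e h (p x) = q (e x) := by
  have hx : (QuotientAddGroup.quotientKerEquivOfSurjective p hp).symm (p x) =
      QuotientAddGroup.mk x :=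
    (AddEquiv.symm_apply_eq _).mpr rfl
  rw [equivOfSurjectiveOfKer, AddEquiv.trans_apply, hx]
  rfl

/-! ### The algebra `ℤM` and the modules induced from `ℤG`. -/

namespace ReesMatrix

variable {G A B : Type*} [Group G] {C : B → A → G}

/-- The algebra `ℤM` of the monoid `M = S¹`. -/
abbrev MonoidRing (C : B → A → G) : Type _ := MonoidAlgebra ℤ (WithOne (ReesMatrix C))

/-- The element `(a, g, b)` of `ℤM`. -/
noncomputable abbrev elt (C : B → A → G) (a : A) (g : G) (b : B) : MonoidRing C :=
  MonoidAlgebra.single ((⟨a, g, b⟩ : ReesMatrix C) : WithOne (ReesMatrix C)) 1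

theorem elt_mul_elt (a a' : A) (g g' : G) (b b' : B) :
    elt C a g b * elt C a' g' b' = elt C a (g * C b a' * g') b' := by
  rw [MonoidAlgebra.single_mul_single, one_mul, ← WithOne.coe_mul, mul_def]

theorem elt_smul_elt_smul {N : Type*} [AddCommGroup N] [Module (MonoidRing C) N]
    (a a' : A) (g g' : G) (b b' : B) (x : N) :
    elt C a g b • elt C a' g' b' • x = elt C a (g * C b a' * g') b' • x := by
  rw [smul_smul, elt_mul_elt]

/-- An additive map commuting with the elements of `S` is `ℤM`-linear. -/
noncomputable def linearMapOfElt {N N' : Type*} [AddCommGroup N] [Module (MonoidRing C) N]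
    [AddCommGroup N'] [Module (MonoidRing C) N'] (f : N →+ N')
    (h : ∀ a g b x, f (elt C a g b • x) = elt C a g b • f x) : N →ₗ[MonoidRing C] N' :=
  MonoidAlgebra.linearMapOfSingle f fun m x => by
    refine WithOne.cases_on m ?_ fun s => h s.left s.mid s.right x
    rw [← MonoidAlgebra.one_def, one_smul, one_smul]

section Induced

variable (C) (X : Type*) [AddCommGroup X] [Module (MonoidAlgebra ℤ G) X]

/-- Multiplication by a group element as a `ℤ`-linear map. -/
noncomputable def groupAct (g : G) : X →ₗ[ℤ] X :=
  (DistribSMul.toAddMonoidHom X (MonoidAlgebra.single g 1 : MonoidAlgebra ℤ G)).toIntLinearMap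

/-- The action of `M` on the induced module. -/
noncomputable def inducedRep : Representation ℤ (WithOne (ReesMatrix C)) (A →₀ X) :=
  WithOne.lift
    { toFun s := Finsupp.lsingle s.left ∘ₗ groupAct X s.mid ∘ₗ
        Finsupp.lsum ℤ fun a' => groupAct X (C s.right a')
      map_mul' s t := by
        refine Finsupp.lhom_ext fun a x => ?_
        simp [mul_def, groupAct, smul_smul, MonoidAlgebra.single_mul_single, mul_assoc] }

/-- The `ℤM`-module induced from a `ℤG`-module `X`: the direct sum of copies of `X` indexed by `A`,
with `(a, g, b) x_{a'} = (g C_{b a'} x)_a`. -/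
def Induced : Type _ := (inducedRep C X).asModule

noncomputable instance : AddCommGroup (Induced C X) :=
  inferInstanceAs (AddCommGroup (inducedRep C X).asModule)

noncomputable instance : Module (MonoidRing C) (Induced C X) :=
  inferInstanceAs (Module (MonoidAlgebra ℤ (WithOne (ReesMatrix C))) (inducedRep C X).asModule)

/-- The underlying group of the induced module. -/
noncomputable def Induced.equivFinsupp : Induced C X ≃+ (A →₀ X) :=
  (inducedRep C X).asModuleEquiv.toAddEquiv

variable {X}

/-- The inclusion of the copy of `X` with index `a`. -/
noncomputable def Induced.single (a : A) : X →+ Induced C X :=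
  (Induced.equivFinsupp C X).symm.toAddMonoidHom.comp (Finsupp.singleAddHom a)

theorem elt_smul_single (a a' : A) (g : G) (b : B) (x : X) :
    elt C a g b • Induced.single C a' x =
      Induced.single C a ((MonoidAlgebra.single (g * C b a') 1 : MonoidAlgebra ℤ G) • x) := by
  refine (Representation.single_smul (inducedRep C X) (1 : ℤ) _ _).trans ?_
  refine (one_zsmul _).trans ?_
  change inducedRep C X ((⟨a, g, b⟩ : ReesMatrix C) : WithOne (ReesMatrix C))
    (Finsupp.single a' x) = Finsupp.single a _
  simp [inducedRep, groupAct, smul_smul, MonoidAlgebra.single_mul_single]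

/-- The additive map out of the induced module with given components. -/
noncomputable def Induced.liftAddHom {N : Type*} [AddCommGroup N] (f : A → X →+ N) :
    Induced C X →+ N :=
  (Finsupp.liftAddHom f).comp (Induced.equivFinsupp C X).toAddMonoidHom

@[simp]
theorem Induced.liftAddHom_single {N : Type*} [AddCommGroup N] (f : A → X →+ N) (a : A) (x : X) :
    Induced.liftAddHom C f (Induced.single C a x) = f a x :=
  Finsupp.liftAddHom_apply_single f a x

variable {C}

theorem Induced.addHom_ext {N : Type*} [AddCommGroup N] {f g : Induced C X →+ N}
    (h : ∀ a x, f (Induced.single C a x) = g (Induced.single C a x)) : f = g :=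
  Finsupp.addHom_ext (f := (f : (A →₀ X) →+ N)) (g := (g : (A →₀ X) →+ N)) h

/-- The copy at `a₀` generates: as `C_{b₀a₀} = 1`, the element `(a, 1, b₀)` carries it identically
onto the copy at `a`. -/
theorem Induced.linearMap_ext_of_row {a₀ : A} {b₀ : B} (hC : IsNormalizedMatrix C a₀ b₀)
    {N : Type*} [AddCommGroup N] [Module (MonoidRing C) N] {f g : Induced C X →ₗ[MonoidRing C] N}
    (h : ∀ x, f (Induced.single C a₀ x) = g (Induced.single C a₀ x)) : f = g := by
  have hfg : f.toAddMonoidHom = g.toAddMonoidHom := Induced.addHom_ext fun a x => by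
    have hx : Induced.single C a x = elt C a 1 b₀ • Induced.single C a₀ x := by
      rw [elt_smul_single, hC.row, one_mul, ← MonoidAlgebra.one_def, one_smul]
    change f _ = g _
    rw [hx, map_smul, map_smul, h]
  exact LinearMap.ext fun x => DFunLike.congr_fun hfg x

/-- The linear map out of the induced module given by an additive map `f : X → N` that is
equivariant along `g ↦ (a₀, g, b₀)`. -/
noncomputable def Induced.lift {a₀ : A} {b₀ : B} (hC : IsNormalizedMatrix C a₀ b₀)
    {N : Type*} [AddCommGroup N] [Module (MonoidRing C) N] (f : X →+ N)
    (hf : ∀ (g : G) x, f ((MonoidAlgebra.single g 1 : MonoidAlgebra ℤ G) • x) =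
      elt C a₀ g b₀ • f x) : Induced C X →ₗ[MonoidRing C] N :=
  linearMapOfElt (Induced.liftAddHom C fun a =>
      (DistribSMul.toAddMonoidHom N (elt C a 1 b₀)).comp f) fun a g b x => by
    refine DFunLike.congr_fun (f := (Induced.liftAddHom C fun a =>
      (DistribSMul.toAddMonoidHom N (elt C a 1 b₀)).comp f).comp
        (DistribSMul.toAddMonoidHom _ (elt C a g b)))
      (g := (DistribSMul.toAddMonoidHom _ (elt C a g b)).comp (Induced.liftAddHom C fun a =>
      (DistribSMul.toAddMonoidHom N (elt C a 1 b₀)).comp f)) (Induced.addHom_ext fun a' x => ?_) x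
    simp only [AddMonoidHom.comp_apply, DistribSMul.toAddMonoidHom_apply, elt_smul_single,
      Induced.liftAddHom_single, hf, elt_smul_elt_smul]
    simp [hC.row]

theorem Induced.lift_single {a₀ : A} {b₀ : B} (hC : IsNormalizedMatrix C a₀ b₀)
    {N : Type*} [AddCommGroup N] [Module (MonoidRing C) N] (f : X →+ N)
    (hf : ∀ (g : G) x, f ((MonoidAlgebra.single g 1 : MonoidAlgebra ℤ G) • x) =
      elt C a₀ g b₀ • f x) (a : A) (x : X) :
    Induced.lift hC f hf (Induced.single C a x) = elt C a 1 b₀ • f x :=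
  Induced.liftAddHom_single C _ a x

variable {Y Z : Type*} [AddCommGroup Y] [Module (MonoidAlgebra ℤ G) Y]
  [AddCommGroup Z] [Module (MonoidAlgebra ℤ G) Z]

variable (C) in
/-- Functoriality of the induced module. -/
noncomputable def Induced.map (φ : X →ₗ[MonoidAlgebra ℤ G] Y) :
    Induced C X →ₗ[MonoidRing C] Induced C Y :=
  linearMapOfElt (Induced.liftAddHom C fun a => (Induced.single C a).comp φ.toAddMonoidHom)
    fun a g b x => by
    refine DFunLike.congr_fun (f := (Induced.liftAddHom C fun a =>
        (Induced.single C a).comp φ.toAddMonoidHom).comp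
        (DistribSMul.toAddMonoidHom _ (elt C a g b)))
      (g := (DistribSMul.toAddMonoidHom _ (elt C a g b)).comp (Induced.liftAddHom C fun a =>
        (Induced.single C a).comp φ.toAddMonoidHom)) (Induced.addHom_ext fun a' x => ?_) x
    simp [elt_smul_single]

@[simp]
theorem Induced.map_single (φ : X →ₗ[MonoidAlgebra ℤ G] Y) (a : A) (x : X) :
    Induced.map C φ (Induced.single C a x) = Induced.single C a (φ x) :=
  Induced.liftAddHom_single C _ a x

theorem Induced.map_eq_mapRange (φ : X →ₗ[MonoidAlgebra ℤ G] Y) (x : Induced C X) :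
    (Induced.equivFinsupp C Y) (Induced.map C φ x) =
      Finsupp.mapRange φ φ.map_zero ((Induced.equivFinsupp C X) x) := by
  refine DFunLike.congr_fun (f := (Induced.equivFinsupp C Y).toAddMonoidHom.comp
    (Induced.map C φ).toAddMonoidHom) (g := (Finsupp.mapRange.addMonoidHom φ.toAddMonoidHom).comp
      (Induced.equivFinsupp C X).toAddMonoidHom) (Induced.addHom_ext fun a x => ?_) x
  change (Induced.equivFinsupp C Y) (Induced.map C φ (Induced.single C a x)) =
    Finsupp.mapRange φ φ.map_zero (Finsupp.single a x)
  rw [Induced.map_single, Finsupp.mapRange_single]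
  rfl

theorem Induced.map_injective {φ : X →ₗ[MonoidAlgebra ℤ G] Y} (h : Function.Injective φ) :
    Function.Injective (Induced.map C φ) := by
  intro x y hxy
  apply (Induced.equivFinsupp C X).injective
  apply Finsupp.mapRange_injective φ φ.map_zero h
  rw [← Induced.map_eq_mapRange, ← Induced.map_eq_mapRange, hxy]

theorem Induced.map_surjective {φ : X →ₗ[MonoidAlgebra ℤ G] Y} (h : Function.Surjective φ) :
    Function.Surjective (Induced.map C φ) := by
  intro y
  obtain ⟨x, hx⟩ := Finsupp.mapRange_surjective φ φ.map_zero h ((Induced.equivFinsupp C Y) y)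
  refine ⟨(Induced.equivFinsupp C X).symm x, (Induced.equivFinsupp C Y).injective ?_⟩
  rw [Induced.map_eq_mapRange, AddEquiv.apply_symm_apply, hx]

theorem Induced.map_exact {φ : X →ₗ[MonoidAlgebra ℤ G] Y} {ψ : Y →ₗ[MonoidAlgebra ℤ G] Z}
    (h : Function.Exact φ ψ) : Function.Exact (Induced.map C φ) (Induced.map C ψ) := by
  classical
  intro y
  constructor
  · intro hy
    have hy' : ∀ a, ψ ((Induced.equivFinsupp C Y) y a) = 0 := fun a => by
      have := DFunLike.congr_fun (Induced.map_eq_mapRange ψ y) a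
      rw [hy, map_zero, Finsupp.mapRange_apply] at this
      exact this.symm
    choose f hf using fun a => (h _).mp (hy' a)
    refine ⟨(Induced.equivFinsupp C X).symm
      (Finsupp.onFinset ((Induced.equivFinsupp C Y) y).support
        -- The chosen preimage of `0` need not be `0`, so it is replaced by `0` to keep the support
        -- finite.
        (fun a => if (Induced.equivFinsupp C Y) y a = 0 then 0 else f a) fun a ha => ?_),
      (Induced.equivFinsupp C Y).injective ?_⟩
    · rw [Finsupp.mem_support_iff]
      exact fun h0 => ha (if_pos h0)
    · rw [Induced.map_eq_mapRange, AddEquiv.apply_symm_apply]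
      ext a
      rw [Finsupp.mapRange_apply, Finsupp.onFinset_apply]
      split_ifs with h0
      · rw [map_zero, h0]
      · exact hf a
  · rintro ⟨x, rfl⟩
    apply (Induced.equivFinsupp C Z).injective
    ext a
    rw [Induced.map_eq_mapRange, Induced.map_eq_mapRange, Finsupp.mapRange_apply,
      Finsupp.mapRange_apply, h.apply_apply_eq_zero, map_zero, Finsupp.zero_apply]

end Induced

/-! ### Projectivity of induced modules. -/

section Free

variable {ι N : Type*} [AddCommGroup N] [Module (MonoidRing C) N]

variable (C) in
/-- The additive extension of `g ↦ (a₀, g, b₀)` to the group ring. -/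
noncomputable def cornerHom (a₀ : A) (b₀ : B) : MonoidAlgebra ℤ G →+ MonoidRing C :=
  MonoidAlgebra.liftNC (Int.castAddHom _) fun g => elt C a₀ g b₀

theorem cornerHom_single (a₀ : A) (b₀ : B) (g : G) :
    cornerHom C a₀ b₀ (MonoidAlgebra.single g 1) = elt C a₀ g b₀ := by
  simp [cornerHom, MonoidAlgebra.liftNC_single]

/-- Multiplicativity on the corner rests on `C_{b₀a₀} = 1`. The corner embedding is not unital: `1`
goes to the idempotent `(a₀, 1, b₀)`. -/
theorem cornerHom_single_mul {a₀ : A} {b₀ : B} (hC : IsNormalizedMatrix C a₀ b₀) (g : G)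
    (z : MonoidAlgebra ℤ G) :
    cornerHom C a₀ b₀ (MonoidAlgebra.single g 1 * z) =
      elt C a₀ g b₀ * cornerHom C a₀ b₀ z := by
  induction z using MonoidAlgebra.induction_linear with
  | zero => rw [mul_zero, map_zero, mul_zero]
  | add x y hx hy => rw [mul_add, map_add, map_add, mul_add, hx, hy]
  | single h k =>
    rw [MonoidAlgebra.single_eq_zsmul h k, mul_smul_comm, map_zsmul, map_zsmul, mul_smul_comm,
      MonoidAlgebra.single_mul_single, one_mul, cornerHom_single, cornerHom_single, elt_mul_elt,
      hC.row, mul_one]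

/-- The linear map out of the module induced from a free module with given values on the basis. -/
noncomputable def Induced.freeLift {a₀ : A} {b₀ : B} (hC : IsNormalizedMatrix C a₀ b₀)
    (n : ι → N) : Induced C (ι →₀ MonoidAlgebra ℤ G) →ₗ[MonoidRing C] N :=
  Induced.lift hC (Finsupp.liftAddHom fun i =>
      ((AddMonoidHom.flip (smulAddHom (MonoidRing C) N)) (n i)).comp (cornerHom C a₀ b₀))
    fun g x => by
    refine DFunLike.congr_fun (f := (Finsupp.liftAddHom fun i =>
        ((AddMonoidHom.flip (smulAddHom (MonoidRing C) N)) (n i)).comp (cornerHom C a₀ b₀)).comp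
          (DistribSMul.toAddMonoidHom _ (MonoidAlgebra.single g 1 : MonoidAlgebra ℤ G)))
      (g := (DistribSMul.toAddMonoidHom _ (elt C a₀ g b₀)).comp (Finsupp.liftAddHom fun i =>
        ((AddMonoidHom.flip (smulAddHom (MonoidRing C) N)) (n i)).comp (cornerHom C a₀ b₀)))
      (Finsupp.addHom_ext fun i z => ?_) x
    simp only [AddMonoidHom.comp_apply, DistribSMul.toAddMonoidHom_apply, Finsupp.smul_single,
      Finsupp.liftAddHom_apply_single, AddMonoidHom.flip_apply, smulAddHom_apply, smul_eq_mul,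
      cornerHom_single_mul hC, mul_smul]

/-- Only the component of `n i` fixed by the idempotent matters: the basis vector itself goes to
`(a₀, 1, b₀) • n i`, not to `n i`. -/
theorem Induced.freeLift_single {a₀ : A} {b₀ : B} (hC : IsNormalizedMatrix C a₀ b₀)
    (n : ι → N) (a : A) (i : ι) (g : G) :
    Induced.freeLift hC n (Induced.single C a (Finsupp.single i (MonoidAlgebra.single g 1))) =
      elt C a g b₀ • n i := by
  refine (Induced.lift_single hC _ _ _ _).trans ?_
  rw [Finsupp.liftAddHom_apply_single, AddMonoidHom.comp_apply, cornerHom_single,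
    AddMonoidHom.flip_apply, smulAddHom_apply, elt_smul_elt_smul, hC.row, mul_one, one_mul]

theorem Induced.single_single {a₀ : A} {b₀ : B} (hC : IsNormalizedMatrix C a₀ b₀)
    (a : A) (i : ι) (g : G) :
    Induced.single C a (Finsupp.single i (MonoidAlgebra.single g (1 : ℤ))) =
      elt C a g b₀ •
        Induced.single C a₀ (Finsupp.single i (MonoidAlgebra.single (1 : G) (1 : ℤ))) := by
  rw [elt_smul_single, Finsupp.smul_single, smul_eq_mul, MonoidAlgebra.single_mul_single, hC.row,
    mul_one, mul_one, mul_one]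

theorem Induced.free_addHom_ext {N : Type*} [AddCommGroup N]
    {f g : Induced C (ι →₀ MonoidAlgebra ℤ G) →+ N}
    (h : ∀ a i x, f (Induced.single C a (Finsupp.single i (MonoidAlgebra.single x 1))) =
      g (Induced.single C a (Finsupp.single i (MonoidAlgebra.single x 1)))) : f = g := by
  refine Induced.addHom_ext fun a x => ?_
  refine DFunLike.congr_fun (f := f.comp (Induced.single C a)) (g := g.comp (Induced.single C a))
    (Finsupp.addHom_ext fun i z => ?_) x
  exact DFunLike.congr_fun (f := (f.comp (Induced.single C a)).comp (Finsupp.singleAddHom i))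
    (g := (g.comp (Induced.single C a)).comp (Finsupp.singleAddHom i))
    (MonoidAlgebra.addHom_ext_single_one fun x => h a i x) z

theorem Induced.free_linearMap_ext {a₀ : A} {b₀ : B} (hC : IsNormalizedMatrix C a₀ b₀)
    {f g : Induced C (ι →₀ MonoidAlgebra ℤ G) →ₗ[MonoidRing C] N}
    (h : ∀ i, f (Induced.single C a₀ (Finsupp.single i (MonoidAlgebra.single 1 1))) =
      g (Induced.single C a₀ (Finsupp.single i (MonoidAlgebra.single 1 1)))) : f = g := by
  have hfg : f.toAddMonoidHom = g.toAddMonoidHom := Induced.free_addHom_ext fun a i x => by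
    change f _ = g _
    rw [Induced.single_single hC, map_smul, map_smul, h]
  exact LinearMap.ext fun x => DFunLike.congr_fun hfg x

/-- The module is a direct sum of copies of `ℤMe` with `e = (a₀, 1, b₀)` idempotent, hence a summand
of a free module. -/
theorem Induced.projective_free {a₀ : A} {b₀ : B} (hC : IsNormalizedMatrix C a₀ b₀) (ι : Type*) :
    Module.Projective (MonoidRing C) (Induced C (ι →₀ MonoidAlgebra ℤ G)) := by
  refine Module.Projective.of_split (M := ι →₀ MonoidRing C)
    (Induced.freeLift hC fun i => Finsupp.single i (elt C a₀ 1 b₀))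
    (Finsupp.linearCombination _ fun i =>
      Induced.single C a₀ (Finsupp.single i (MonoidAlgebra.single 1 1)))
    (Induced.free_linearMap_ext hC fun i => ?_)
  rw [LinearMap.comp_apply, Induced.freeLift_single, Finsupp.smul_single, smul_eq_mul, elt_mul_elt,
    Finsupp.linearCombination_single, hC.row, mul_one, mul_one, ← Induced.single_single hC,
    LinearMap.id_apply]

theorem Induced.projective {a₀ : A} {b₀ : B} (hC : IsNormalizedMatrix C a₀ b₀) (X : Type*)
    [AddCommGroup X] [Module (MonoidAlgebra ℤ G) X] [h : Module.Projective (MonoidAlgebra ℤ G) X] :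
    Module.Projective (MonoidRing C) (Induced C X) := by
  obtain ⟨s, hs⟩ := Module.projective_def'.mp h
  have := Induced.projective_free hC X
  refine Module.Projective.of_split (Induced.map C s)
    (Induced.map C (Finsupp.linearCombination (MonoidAlgebra ℤ G) id))
    (Induced.linearMap_ext_of_row hC fun x => ?_)
  rw [LinearMap.comp_apply, Induced.map_single, Induced.map_single, LinearMap.id_apply]
  exact congrArg _ (LinearMap.congr_fun hs x)

end Free

end ReesMatrix

/-! ### `Ext` from induced modules to the trivial module. -/

namespace ReesMatrix

variable {G A B : Type u} [Group G] {C : B → A → G} {a₀ : A} {b₀ : B}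

/-- The trivial module over `ℤM`. -/
noncomputable abbrev trivialModule (C : B → A → G) : ModuleCat.{u} (MonoidRing C) :=
  trivialIntModule (WithOne (ReesMatrix C))

/-- The identification of the groups underlying the trivial modules over `ℤM` and `ℤG`. -/
def trivialModuleEquiv (C : B → A → G) : trivialModule C ≃+ trivialIntModule G :=
  (trivialIntModuleEquiv _).trans (trivialIntModuleEquiv G).symm

theorem elt_smul_trivialModule (a : A) (g : G) (b : B) (x : trivialModule C) :
    elt C a g b • x = x :=
  single_smul_trivialIntModule _ x

variable (X : Type u) [AddCommGroup X] [Module (MonoidAlgebra ℤ G) X]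

variable {X} in
/-- The extension of a map to the trivial module to the induced module. -/
noncomputable def Induced.liftTrivial (hC : IsNormalizedMatrix C a₀ b₀)
    (f : X →ₗ[MonoidAlgebra ℤ G] trivialIntModule G) :
    Induced C X →ₗ[MonoidRing C] trivialModule C :=
  Induced.lift hC ((trivialModuleEquiv C).symm.toAddMonoidHom.comp f.toAddMonoidHom)
    fun g x => by
    rw [elt_smul_trivialModule]
    change (trivialModuleEquiv C).symm (f _) = (trivialModuleEquiv C).symm (f _)
    rw [map_smul, single_smul_trivialIntModule]

variable {X} in
theorem Induced.liftTrivial_single (hC : IsNormalizedMatrix C a₀ b₀)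
    (f : X →ₗ[MonoidAlgebra ℤ G] trivialIntModule G) (a : A) (x : X) :
    Induced.liftTrivial hC f (Induced.single C a x) = (trivialModuleEquiv C).symm (f x) :=
  (Induced.lift_single hC _ _ a x).trans (elt_smul_trivialModule _ _ _ _)

/-- Maps from an induced module to the trivial module. -/
noncomputable def Induced.homTrivialEquiv (hC : IsNormalizedMatrix C a₀ b₀) :
    (Induced C X →ₗ[MonoidRing C] trivialModule C) ≃+
      (X →ₗ[MonoidAlgebra ℤ G] trivialIntModule G) where
  toFun f := MonoidAlgebra.linearMapOfSingle ((trivialModuleEquiv C).toAddMonoidHom.comp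
      (f.toAddMonoidHom.comp (Induced.single C a₀))) fun g x => by
    have h : Induced.single C a₀ ((MonoidAlgebra.single g 1 : MonoidAlgebra ℤ G) • x) =
        elt C a₀ g b₀ • Induced.single C a₀ x := by
      rw [elt_smul_single, hC.row, mul_one]
    rw [single_smul_trivialIntModule]
    change trivialModuleEquiv C (f _) = trivialModuleEquiv C (f _)
    rw [h, map_smul, elt_smul_trivialModule]
  invFun := Induced.liftTrivial hC
  left_inv f := by
    refine Induced.linearMap_ext_of_row hC fun x => ?_
    rw [Induced.liftTrivial_single]
    exact (trivialModuleEquiv C).symm_apply_apply _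
  right_inv f := by
    refine LinearMap.ext fun x => ?_
    exact (congrArg (trivialModuleEquiv C) (Induced.liftTrivial_single hC f a₀ x)).trans
      ((trivialModuleEquiv C).apply_symm_apply _)
  map_add' f f' := LinearMap.ext fun x => map_add (trivialModuleEquiv C) _ _

theorem Induced.homTrivialEquiv_apply (hC : IsNormalizedMatrix C a₀ b₀)
    (f : Induced C X →ₗ[MonoidRing C] trivialModule C) (x : X) :
    Induced.homTrivialEquiv X hC f x = trivialModuleEquiv C (f (Induced.single C a₀ x)) := rfl

-- Naturality of the adjunction: a map extends along `φ` over `ℤG` exactly when its transpose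
-- extends along the induced map.
variable {X} in
theorem Induced.homTrivialEquiv_comp_map (hC : IsNormalizedMatrix C a₀ b₀) {Y : Type u}
    [AddCommGroup Y] [Module (MonoidAlgebra ℤ G) Y] (φ : X →ₗ[MonoidAlgebra ℤ G] Y)
    (f : Induced C Y →ₗ[MonoidRing C] trivialModule C) :
    Induced.homTrivialEquiv X hC (f ∘ₗ Induced.map C φ) =
      Induced.homTrivialEquiv Y hC f ∘ₗ φ := by
  refine LinearMap.ext fun x => ?_
  rw [LinearMap.comp_apply, Induced.homTrivialEquiv_apply, Induced.homTrivialEquiv_apply,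
    LinearMap.comp_apply, Induced.map_single]

section Presentation

variable (G) in
/-- The canonical map from a free module onto `X`. -/
noncomputable abbrev freeCover : (X →₀ MonoidAlgebra ℤ G) →ₗ[MonoidAlgebra ℤ G] X :=
  Finsupp.linearCombination (MonoidAlgebra ℤ G) id

variable (G) in
theorem freeCover_exact :
    Function.Exact (LinearMap.ker (freeCover G X)).subtype (freeCover G X) :=
  LinearMap.exact_subtype_ker_map _

variable (G) in
theorem freeCover_shortExact :
    (ModuleCat.shortComplexOfExact (X := LinearMap.ker (freeCover G X)) (Submodule.subtype _)
      (freeCover G X) (freeCover_exact G X)).ShortExact :=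
  ModuleCat.shortExact_of_exact (Submodule.subtype_injective _)
    (Finsupp.linearCombination_id_surjective _ _) _

variable (C) in
theorem Induced.freeCover_shortExact :
    (ModuleCat.shortComplexOfExact
      (Induced.map C (X := LinearMap.ker (freeCover G X)) (Submodule.subtype _))
      (Induced.map C (freeCover G X))
      (Induced.map_exact (X := LinearMap.ker (freeCover G X)) (freeCover_exact G X))).ShortExact :=
  ModuleCat.shortExact_of_exact (Induced.map_injective (Submodule.subtype_injective _))
    (Induced.map_surjective (Finsupp.linearCombination_id_surjective _ _)) _

theorem Induced.projective_of (hC : IsNormalizedMatrix C a₀ b₀)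
    [Module.Projective (MonoidAlgebra ℤ G) X] :
    Projective (ModuleCat.of (MonoidRing C) (Induced C X)) := by
  have := Induced.projective hC X
  exact (IsProjective.iff_projective _).mp inferInstance

instance : Projective (ModuleCat.of (MonoidAlgebra ℤ G) (X →₀ MonoidAlgebra ℤ G)) :=
  (IsProjective.iff_projective _).mp inferInstance

end Presentation

/-- `Ext¹` of an induced module. -/
theorem nonempty_ext_one_induced_equiv (hC : IsNormalizedMatrix C a₀ b₀) :
    Nonempty (Ext (ModuleCat.of (MonoidRing C) (Induced C X)) (trivialModule C) 1 ≃+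
      Ext (ModuleCat.of (MonoidAlgebra ℤ G) X) (trivialIntModule G) 1) := by
  have := Induced.projective_of (X →₀ MonoidAlgebra ℤ G) hC
  refine ⟨AddMonoidHom.equivOfSurjectiveOfKer _ _
    ((Induced.freeCover_shortExact C X).homToExt_surjective (trivialModule C))
    ((freeCover_shortExact G X).homToExt_surjective (trivialIntModule G))
    (ModuleCat.homAddEquiv.trans ((Induced.homTrivialEquiv (LinearMap.ker (freeCover G X)) hC).trans
      (ModuleCat.homAddEquiv (M := ModuleCat.of _ (LinearMap.ker (freeCover G X)))
        (N := trivialIntModule G)).symm)) fun φ => ?_⟩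
  -- On both sides the classes to be killed are the restrictions from the cover, and the adjunction
  -- matches them.
  rw [ShortComplex.ShortExact.homToExt_eq_zero_iff, ShortComplex.ShortExact.homToExt_eq_zero_iff]
  constructor
  · rintro ⟨ψ, rfl⟩
    refine ⟨ModuleCat.ofHom (Induced.homTrivialEquiv _ hC ψ.hom), ?_⟩
    ext1
    exact (Induced.homTrivialEquiv_comp_map hC _ _).symm
  · rintro ⟨ψ, hψ⟩
    refine ⟨ModuleCat.ofHom ((Induced.homTrivialEquiv _ hC).symm ψ.hom), ?_⟩
    ext1
    apply (Induced.homTrivialEquiv _ hC).injective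
    refine (Induced.homTrivialEquiv_comp_map hC _ _).trans
      (Eq.trans ?_ (congrArg ModuleCat.Hom.hom hψ))
    exact congrArg (· ∘ₗ (LinearMap.ker (freeCover G X)).subtype)
      ((Induced.homTrivialEquiv _ hC).apply_symm_apply ψ.hom)

/-- Positive-degree `Ext` of an induced module. -/
theorem nonempty_ext_induced_equiv (hC : IsNormalizedMatrix C a₀ b₀) (n : ℕ) (X : Type u)
    [AddCommGroup X] [Module (MonoidAlgebra ℤ G) X] :
    Nonempty (Ext (ModuleCat.of (MonoidRing C) (Induced C X)) (trivialModule C) (n + 1) ≃+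
      Ext (ModuleCat.of (MonoidAlgebra ℤ G) X) (trivialIntModule G) (n + 1)) := by
  induction n generalizing X with
  | zero => exact nonempty_ext_one_induced_equiv X hC
  | succ n ih =>
    have := Induced.projective_of (X →₀ MonoidAlgebra ℤ G) hC
    -- Shifting degree replaces `X` by its module of relations, so the induction has to run over all
    -- modules at once.
    obtain ⟨e⟩ := ih (LinearMap.ker (freeCover G X))
    exact ⟨((Induced.freeCover_shortExact C X).extShift (trivialModule C) n).symm.trans
      (e.trans ((freeCover_shortExact G X).extShift (trivialIntModule G) n))⟩

end ReesMatrix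

/-- The additive extension of a function on `M` to `ℤM`. -/
noncomputable def MonoidAlgebra.intLiftAddHom {M N : Type*} [AddCommGroup N] (f : M → N) :
    MonoidAlgebra ℤ M →+ N :=
  (Finsupp.liftAddHom fun m => zmultiplesHom N (f m)).comp
    { toFun := MonoidAlgebra.coeff
      map_zero' := rfl
      map_add' _ _ := rfl }

@[simp]
theorem MonoidAlgebra.intLiftAddHom_single {M N : Type*} [AddCommGroup N] (f : M → N) (m : M)
    (k : ℤ) : MonoidAlgebra.intLiftAddHom f (MonoidAlgebra.single m k) = k • f m :=
  (Finsupp.liftAddHom_apply_single (fun m => zmultiplesHom N (f m)) m k).trans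
    (zmultiplesHom_apply _ _ _)

namespace ReesMatrix

variable {G A B : Type u} [Group G] {C : B → A → G} {a₀ : A} {b₀ : B}

/-! ### The sequence `0 → K → ℤA → ℤ → 0`. -/

section AugmentationKernel

/-- The representation of `M` on `ℤ^{(Ā)}` for which the elements of `S` act as zero. -/
noncomputable def augmentationKernelRep (C : B → A → G) (a₀ : A) :
    Representation ℤ (WithOne (ReesMatrix C)) ({a : A // a ≠ a₀} →₀ ℤ) :=
  WithOne.lift { toFun _ := 0, map_mul' _ _ := (mul_zero _).symm }

/-- The `ℤM`-module `ℤ^{(Ā)}` on which the elements of `S` act as zero. -/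
def AugmentationKernel (C : B → A → G) (a₀ : A) : Type u := (augmentationKernelRep C a₀).asModule

namespace AugmentationKernel

noncomputable instance : AddCommGroup (AugmentationKernel C a₀) :=
  inferInstanceAs (AddCommGroup (augmentationKernelRep C a₀).asModule)

noncomputable instance : Module (MonoidRing C) (AugmentationKernel C a₀) :=
  inferInstanceAs (Module (MonoidAlgebra ℤ (WithOne (ReesMatrix C)))
    (augmentationKernelRep C a₀).asModule)

theorem elt_smul (a : A) (g : G) (b : B) (x : AugmentationKernel C a₀) : elt C a g b • x = 0 := by
  refine (Representation.single_smul (augmentationKernelRep C a₀) (1 : ℤ) _ x).trans ?_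
  refine (one_zsmul _).trans ?_
  rw [augmentationKernelRep, WithOne.lift_coe]
  rfl

/-- Multiples of the basis vector with index `a`. -/
noncomputable def single (C : B → A → G) (a : {a : A // a ≠ a₀}) : ℤ →+ AugmentationKernel C a₀ :=
  Finsupp.singleAddHom a

/-- The additive map with given components. -/
noncomputable def liftAddHom (C : B → A → G) {N : Type*} [AddCommGroup N]
    (f : {a : A // a ≠ a₀} → ℤ →+ N) : AugmentationKernel C a₀ →+ N :=
  Finsupp.liftAddHom f

@[simp]
theorem liftAddHom_single {N : Type*} [AddCommGroup N] (f : {a : A // a ≠ a₀} → ℤ →+ N)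
    (a : {a : A // a ≠ a₀}) (k : ℤ) : liftAddHom C f (single C a k) = f a k :=
  Finsupp.liftAddHom_apply_single f a k

theorem addHom_ext {N : Type*} [AddCommGroup N] {f g : AugmentationKernel C a₀ →+ N}
    (h : ∀ a, f (single C a 1) = g (single C a 1)) : f = g :=
  Finsupp.addHom_ext' (f := (f : ({a : A // a ≠ a₀} →₀ ℤ) →+ N))
    (g := (g : ({a : A // a ≠ a₀} →₀ ℤ) →+ N)) fun a => AddMonoidHom.ext_int (h a)

/-- The map `a ↦ a - a₀` to `ℤA`. -/
noncomputable def toInduced (C : B → A → G) (a₀ : A) :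
    AugmentationKernel C a₀ →ₗ[MonoidRing C] Induced C (trivialIntModule G) :=
  linearMapOfElt (liftAddHom C fun a =>
      (Induced.single C (a : A) - Induced.single C a₀).comp
        (trivialIntModuleEquiv G).symm.toAddMonoidHom) fun a g b x => by
    rw [elt_smul, map_zero]
    refine DFunLike.congr_fun (f := (0 : AugmentationKernel C a₀ →+ _))
      (g := (DistribSMul.toAddMonoidHom _ (elt C a g b)).comp (liftAddHom C fun a =>
      (Induced.single C (a : A) - Induced.single C a₀).comp
        (trivialIntModuleEquiv G).symm.toAddMonoidHom)) (addHom_ext fun a' => ?_) x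
    simp only [AddMonoidHom.comp_apply, AddMonoidHom.zero_apply, liftAddHom_single,
      AddMonoidHom.sub_apply, DistribSMul.toAddMonoidHom_apply, smul_sub, elt_smul_single]
    -- Both `a'` and `a₀` are sent to `a`, because the entries of `C` act trivially on `ℤ`; hence
    -- `S` kills their difference.
    rw [single_smul_trivialIntModule, single_smul_trivialIntModule, sub_self]

theorem toInduced_single (a : {a : A // a ≠ a₀}) (k : ℤ) :
    toInduced C a₀ (single C a k) =
      Induced.single C (a : A) ((trivialIntModuleEquiv G).symm k) -
        Induced.single C a₀ ((trivialIntModuleEquiv G).symm k) :=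
  liftAddHom_single _ a k

end AugmentationKernel

/-- The augmentation `ℤA → ℤ`. -/
noncomputable def augmentation (hC : IsNormalizedMatrix C a₀ b₀) :
    Induced C (trivialIntModule G) →ₗ[MonoidRing C] trivialModule C :=
  Induced.liftTrivial hC LinearMap.id

theorem augmentation_single (hC : IsNormalizedMatrix C a₀ b₀) (a : A) (x : trivialIntModule G) :
    augmentation hC (Induced.single C a x) = (trivialModuleEquiv C).symm x :=
  Induced.liftTrivial_single hC _ a x

open Classical in
/-- The projection `ℤA → ℤ^{(Ā)}`. -/
noncomputable def augmentationRetraction (C : B → A → G) (a₀ : A) :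
    Induced C (trivialIntModule G) →+ AugmentationKernel C a₀ :=
  Induced.liftAddHom C fun a => if h : a = a₀ then 0 else
    (AugmentationKernel.single C ⟨a, h⟩).comp (trivialIntModuleEquiv G).toAddMonoidHom

theorem augmentationRetraction_single_self (x : trivialIntModule G) :
    augmentationRetraction C a₀ (Induced.single C a₀ x) = 0 := by
  rw [augmentationRetraction, Induced.liftAddHom_single, dif_pos rfl, AddMonoidHom.zero_apply]

theorem augmentationRetraction_single (a : {a : A // a ≠ a₀}) (x : trivialIntModule G) :
    augmentationRetraction C a₀ (Induced.single C (a : A) x) =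
      AugmentationKernel.single C a (trivialIntModuleEquiv G x) := by
  rw [augmentationRetraction, Induced.liftAddHom_single, dif_neg a.2]
  rfl

/-- The sequence splits over `ℤ`, by `1 ↦ a₀` and by forgetting the coordinate at `a₀`. The
splitting need only be additive. -/
theorem augmentation_exact (hC : IsNormalizedMatrix C a₀ b₀) :
    Function.Exact (AugmentationKernel.toInduced C a₀) (augmentation hC) := by
  refine Function.Exact.of_additive_splitting
    (f := (AugmentationKernel.toInduced C a₀).toAddMonoidHom)
    (g := (augmentation hC).toAddMonoidHom) (κ := augmentationRetraction C a₀)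
    (σ := (Induced.single C a₀).comp (trivialModuleEquiv C).toAddMonoidHom)
    (AugmentationKernel.addHom_ext fun a => ?_) (Induced.addHom_ext fun a x => ?_)
  · change augmentation hC (AugmentationKernel.toInduced C a₀ _) = 0
    rw [AugmentationKernel.toInduced_single, map_sub, augmentation_single, augmentation_single,
      sub_self]
  · change AugmentationKernel.toInduced C a₀ (augmentationRetraction C a₀ (Induced.single C a x)) +
      Induced.single C a₀ (trivialModuleEquiv C (augmentation hC (Induced.single C a x))) = _
    rw [augmentation_single, AddEquiv.apply_symm_apply]
    by_cases h : a = a₀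
    · subst h
      rw [augmentationRetraction_single_self, map_zero, zero_add, AddMonoidHom.id_apply]
    · rw [augmentationRetraction_single ⟨a, h⟩, AugmentationKernel.toInduced_single,
        AddEquiv.symm_apply_apply, sub_add_cancel, AddMonoidHom.id_apply]

theorem augmentation_shortExact (hC : IsNormalizedMatrix C a₀ b₀) :
    (ModuleCat.shortComplexOfExact _ _ (augmentation_exact hC)).ShortExact := by
  refine ModuleCat.shortExact_of_exact ?_ ?_ _
  · refine Function.LeftInverse.injective (g := augmentationRetraction C a₀) fun x => ?_
    refine DFunLike.congr_fun (f := (augmentationRetraction C a₀).comp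
      (AugmentationKernel.toInduced C a₀).toAddMonoidHom) (g := AddMonoidHom.id _)
      (AugmentationKernel.addHom_ext fun a => ?_) x
    change augmentationRetraction C a₀ (AugmentationKernel.toInduced C a₀ _) = _
    rw [AugmentationKernel.toInduced_single, map_sub, augmentationRetraction_single_self, sub_zero,
      augmentationRetraction_single, AddEquiv.apply_symm_apply, AddMonoidHom.id_apply]
  · intro x
    exact ⟨Induced.single C a₀ (trivialModuleEquiv C x), by
      rw [augmentation_single, AddEquiv.symm_apply_apply]⟩

/-- The element `(a₀, 1, b₀)` acts as zero on the source and as the identity on the target. -/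
theorem AugmentationKernel.hom_trivial_eq_zero (b₀ : B)
    (f : AugmentationKernel C a₀ →ₗ[MonoidRing C] trivialModule C) : f = 0 := by
  refine LinearMap.ext fun x => ?_
  rw [← elt_smul_trivialModule a₀ 1 b₀ (f x), ← map_smul, AugmentationKernel.elt_smul, map_zero,
    LinearMap.zero_apply]

end AugmentationKernel

/-! ### A projective resolution of `K` of length one. -/

section KernelResolution

variable (C a₀) in
/-- The free module covering the augmentation kernel. -/
abbrev KernelCover : Type u := {a : A // a ≠ a₀} →₀ MonoidRing C

variable (C a₀) in
/-- The induced module of relations of the augmentation kernel. -/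
abbrev KernelRelations : Type u := Induced C (({a : A // a ≠ a₀} × B) →₀ MonoidAlgebra ℤ G)

variable (C) in
/-- The generators of the relations of the augmentation kernel. -/
noncomputable def kernelRelation (p : {a : A // a ≠ a₀} × B) : KernelRelations C a₀ :=
  Induced.single C a₀ (Finsupp.single p (MonoidAlgebra.single 1 1))

variable (C a₀) in
/-- The free cover of the augmentation kernel. -/
noncomputable def kernelCover : KernelCover C a₀ →ₗ[MonoidRing C] AugmentationKernel C a₀ :=
  Finsupp.linearCombination _ fun a => AugmentationKernel.single C a 1

/-- The inclusion of the relations of the augmentation kernel. -/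
noncomputable def kernelRelations (hC : IsNormalizedMatrix C a₀ b₀) :
    KernelRelations C a₀ →ₗ[MonoidRing C] KernelCover C a₀ :=
  Induced.freeLift hC fun p => Finsupp.single p.1 (elt C a₀ 1 p.2)

theorem kernelRelations_single (hC : IsNormalizedMatrix C a₀ b₀) (a : A)
    (p : {a : A // a ≠ a₀} × B) (g : G) :
    kernelRelations hC (Induced.single C a (Finsupp.single p (MonoidAlgebra.single g 1))) =
      Finsupp.single p.1 (elt C a g p.2) := by
  rw [kernelRelations, Induced.freeLift_single, Finsupp.smul_single, smul_eq_mul, elt_mul_elt,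
    hC.row, mul_one, mul_one]

variable (C a₀) in
/-- The additive retraction onto the relations of the augmentation kernel. -/
noncomputable def kernelRetraction : KernelCover C a₀ →+ KernelRelations C a₀ :=
  -- The default `0` is the value at the adjoined identity, which is the part of the cover that
  -- survives in `K`.
  Finsupp.liftAddHom fun a => MonoidAlgebra.intLiftAddHom fun m => Option.elim m 0
    fun s : ReesMatrix C =>
      Induced.single C s.left (Finsupp.single (a, s.right) (MonoidAlgebra.single s.mid 1))

theorem kernelRetraction_single_one (a : {a : A // a ≠ a₀}) :
    kernelRetraction C a₀ (Finsupp.single a 1) = 0 := by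
  rw [kernelRetraction, Finsupp.liftAddHom_apply_single, MonoidAlgebra.one_def,
    MonoidAlgebra.intLiftAddHom_single, one_smul]
  rfl

theorem kernelRetraction_single_elt (a : {a : A // a ≠ a₀}) (a' : A) (g : G) (b : B) :
    kernelRetraction C a₀ (Finsupp.single a (elt C a' g b)) =
      Induced.single C a' (Finsupp.single (a, b) (MonoidAlgebra.single g (1 : ℤ))) := by
  rw [kernelRetraction, Finsupp.liftAddHom_apply_single,
    MonoidAlgebra.intLiftAddHom_single, one_smul]
  rfl

theorem kernelCover_single (a : {a : A // a ≠ a₀}) (r : MonoidRing C) :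
    kernelCover C a₀ (Finsupp.single a r) = r • AugmentationKernel.single C a 1 :=
  Finsupp.linearCombination_single _ _ _

theorem KernelCover.addHom_ext {N : Type*} [AddCommGroup N] {f g : KernelCover C a₀ →+ N}
    (h₁ : ∀ a, f (Finsupp.single a 1) = g (Finsupp.single a 1))
    (h₂ : ∀ a a' x b, f (Finsupp.single a (elt C a' x b)) = g (Finsupp.single a (elt C a' x b))) :
    f = g := by
  refine Finsupp.addHom_ext fun a r => ?_
  refine DFunLike.congr_fun (f := f.comp (Finsupp.singleAddHom a))
    (g := g.comp (Finsupp.singleAddHom a)) (MonoidAlgebra.addHom_ext_single_one fun m => ?_) r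
  refine WithOne.cases_on m (h₁ a) fun s => h₂ a s.left s.mid s.right

/-- Additively `ℤM = ℤ ⊕ ℤS`. In each summand of the cover the part `ℤ` maps isomorphically to a
coordinate of `K`, while `ℤS` is the sum over `b` of the spans of the `(a', g, b)`, each a copy of
`ℤMe`. -/
theorem kernelCover_exact (hC : IsNormalizedMatrix C a₀ b₀) :
    Function.Exact (kernelRelations hC) (kernelCover C a₀) := by
  refine Function.Exact.of_additive_splitting
    (f := (kernelRelations hC).toAddMonoidHom)
    (g := (kernelCover C a₀).toAddMonoidHom) (κ := kernelRetraction C a₀)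
    (σ := AugmentationKernel.liftAddHom C fun a => zmultiplesHom _ (Finsupp.single a 1))
    (Induced.free_addHom_ext fun a p g => ?_)
    (KernelCover.addHom_ext (fun a => ?_) fun a a' g b => ?_)
  · change kernelCover C a₀ (kernelRelations hC
      (Induced.single C a (Finsupp.single p (MonoidAlgebra.single g 1)))) = 0
    rw [kernelRelations_single, kernelCover_single, AugmentationKernel.elt_smul]
  · change kernelRelations hC (kernelRetraction C a₀ _) +
      AugmentationKernel.liftAddHom C _ (kernelCover C a₀ _) = _
    rw [kernelRetraction_single_one, kernelCover_single, one_smul, map_zero, zero_add,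
      AugmentationKernel.liftAddHom_single, zmultiplesHom_apply, one_smul, AddMonoidHom.id_apply]
  · change kernelRelations hC (kernelRetraction C a₀ _) +
      AugmentationKernel.liftAddHom C _ (kernelCover C a₀ _) = _
    rw [kernelRetraction_single_elt, kernelCover_single, AugmentationKernel.elt_smul, map_zero,
      add_zero, kernelRelations_single, AddMonoidHom.id_apply]

theorem kernelCover_shortExact (hC : IsNormalizedMatrix C a₀ b₀) :
    (ModuleCat.shortComplexOfExact _ _ (kernelCover_exact hC)).ShortExact := by
  refine ModuleCat.shortExact_of_exact ?_ ?_ _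
  · refine Function.LeftInverse.injective (g := kernelRetraction C a₀) fun x => ?_
    refine DFunLike.congr_fun (f := (kernelRetraction C a₀).comp
      (kernelRelations hC).toAddMonoidHom) (g := AddMonoidHom.id _)
      (Induced.free_addHom_ext fun a p g => ?_) x
    change kernelRetraction C a₀ (kernelRelations hC
      (Induced.single C a (Finsupp.single p (MonoidAlgebra.single g 1)))) = _
    rw [kernelRelations_single, kernelRetraction_single_elt, AddMonoidHom.id_apply]
  · intro x
    refine ⟨AugmentationKernel.liftAddHom C
      (fun a => zmultiplesHom (KernelCover C a₀) (Finsupp.single a 1)) x, ?_⟩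
    refine DFunLike.congr_fun (f := (kernelCover C a₀).toAddMonoidHom.comp
      (AugmentationKernel.liftAddHom C
        (fun a => zmultiplesHom (KernelCover C a₀) (Finsupp.single a 1))))
      (g := AddMonoidHom.id _) (AugmentationKernel.addHom_ext fun a => ?_) x
    rw [AddMonoidHom.comp_apply, AugmentationKernel.liftAddHom_single, zmultiplesHom_apply,
      one_smul, AddMonoidHom.id_apply]
    exact (kernelCover_single a 1).trans (one_smul _ _)

end KernelResolution

end ReesMatrix

namespace ReesMatrix

variable {G A B : Type u} [Group G] {C : B → A → G} {a₀ : A} {b₀ : B}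

/-! ### The groups `Extⁿ(K, ℤ)`. -/

section KernelExt

variable (C a₀) in
/-- The augmentation kernel as an object. -/
noncomputable abbrev kernelObj : ModuleCat.{u} (MonoidRing C) :=
  ModuleCat.of (MonoidRing C) (AugmentationKernel C a₀)

theorem kernelRelations_projective (hC : IsNormalizedMatrix C a₀ b₀) :
    Projective (ModuleCat.of (MonoidRing C) (KernelRelations C a₀)) :=
  Induced.projective_of _ hC

instance : Projective (ModuleCat.of (MonoidRing C) (KernelCover C a₀)) :=
  (IsProjective.iff_projective _).mp inferInstance

theorem subsingleton_ext_kernel_zero (b₀ : B) :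
    Subsingleton (Ext (kernelObj C a₀) (trivialModule C) 0) := by
  refine Ext.addEquiv₀.toEquiv.subsingleton_congr.mpr ⟨fun f g => ?_⟩
  ext1
  rw [AugmentationKernel.hom_trivial_eq_zero b₀ f.hom,
    AugmentationKernel.hom_trivial_eq_zero b₀ g.hom]

/-- The relations are themselves projective, so `K` has projective dimension at most one. -/
theorem subsingleton_ext_kernel_add_two (hC : IsNormalizedMatrix C a₀ b₀) (n : ℕ) :
    Subsingleton (Ext (kernelObj C a₀) (trivialModule C) (n + 2)) := by
  have := kernelRelations_projective hC
  have := Ext.subsingleton_of_projective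
    (ModuleCat.of (MonoidRing C) (KernelRelations C a₀)) (trivialModule C) n
  exact ((kernelCover_shortExact hC).extShift (trivialModule C) n).toEquiv.symm.subsingleton

variable (C a₀ b₀) in
/-- The values of a homomorphism on the generating relations, normalized at `b₀`. -/
noncomputable def relationValues :
    (ModuleCat.of (MonoidRing C) (KernelRelations C a₀) ⟶ trivialModule C) →+
      ({a : A // a ≠ a₀} × {b : B // b ≠ b₀} → ℤ) where
  toFun f p := trivialIntModuleEquiv _ (f.hom (kernelRelation C (p.1, (p.2 : B)))) -
    trivialIntModuleEquiv _ (f.hom (kernelRelation C (p.1, b₀)))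
  map_zero' := by
    ext p
    simp
  map_add' f g := by
    ext p
    simp only [ModuleCat.hom_add, LinearMap.add_apply, map_add, Pi.add_apply]
    ring

theorem relationValues_apply
    (f : ModuleCat.of (MonoidRing C) (KernelRelations C a₀) ⟶ trivialModule C)
    (p : {a : A // a ≠ a₀} × {b : B // b ≠ b₀}) :
    relationValues C a₀ b₀ f p =
      trivialIntModuleEquiv _ (f.hom (kernelRelation C (p.1, (p.2 : B)))) -
        trivialIntModuleEquiv _ (f.hom (kernelRelation C (p.1, b₀))) := rfl

theorem freeLift_kernelRelation (hC : IsNormalizedMatrix C a₀ b₀)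
    (n : {a : A // a ≠ a₀} × B → trivialModule C) (p : {a : A // a ≠ a₀} × B) :
    Induced.freeLift hC n (kernelRelation C p) = n p :=
  (Induced.freeLift_single hC n a₀ p 1).trans (elt_smul_trivialModule _ _ _ _)

theorem relationValues_surjective (hC : IsNormalizedMatrix C a₀ b₀) :
    Function.Surjective (relationValues C a₀ b₀) := by
  classical
  intro v
  let n : {a : A // a ≠ a₀} × B → trivialModule C := fun p =>
    -- The value `0` at `b₀` makes the normalizing term in `relationValues` vanish.
    (trivialIntModuleEquiv _).symm (if h : p.2 = b₀ then 0 else v (p.1, ⟨p.2, h⟩))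
  refine ⟨ModuleCat.ofHom (Induced.freeLift hC n), funext fun p => ?_⟩
  rw [relationValues_apply, ModuleCat.hom_ofHom, freeLift_kernelRelation, freeLift_kernelRelation,
    AddEquiv.apply_symm_apply, AddEquiv.apply_symm_apply, dif_neg p.2.2, dif_pos rfl, sub_zero]

theorem kernelRelations_kernelRelation (hC : IsNormalizedMatrix C a₀ b₀)
    (p : {a : A // a ≠ a₀} × B) :
    kernelRelations hC (kernelRelation C p) = Finsupp.single p.1 (elt C a₀ 1 p.2) :=
  kernelRelations_single hC a₀ p 1

/-- The relation at `(a, b)` is `(a₀, 1, b)` times the basis vector at `a`. A map defined on the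
cover therefore takes on it the value at that basis vector, whatever `b` is; conversely, values
independent of `b` prescribe the extension. -/
theorem relationValues_eq_zero_iff (hC : IsNormalizedMatrix C a₀ b₀)
    (f : ModuleCat.of (MonoidRing C) (KernelRelations C a₀) ⟶ trivialModule C) :
    relationValues C a₀ b₀ f = 0 ↔
      ∃ ψ : ModuleCat.of (MonoidRing C) (KernelCover C a₀) ⟶ trivialModule C,
        ModuleCat.ofHom (kernelRelations hC) ≫ ψ = f := by
  constructor
  · intro h
    have h' : ∀ p, f.hom (kernelRelation C p) = f.hom (kernelRelation C (p.1, b₀)) := by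
      rintro ⟨a, b⟩
      by_cases hb : b = b₀
      · rw [hb]
      · have := congrFun h (a, ⟨b, hb⟩)
        rw [relationValues_apply, Pi.zero_apply, sub_eq_zero] at this
        exact (trivialIntModuleEquiv _).injective this
    refine ⟨ModuleCat.ofHom (Finsupp.linearCombination (MonoidRing C)
      fun a => f.hom (kernelRelation C (a, b₀))), ?_⟩
    ext1
    refine Induced.free_linearMap_ext hC fun p => ?_
    change Finsupp.linearCombination (MonoidRing C) (fun a => f.hom (kernelRelation C (a, b₀)))
      (kernelRelations hC (kernelRelation C p)) = f.hom (kernelRelation C p)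
    rw [kernelRelations_kernelRelation, Finsupp.linearCombination_single, elt_smul_trivialModule,
      h' p]
  · rintro ⟨ψ, rfl⟩
    have h : ∀ p, (ModuleCat.ofHom (kernelRelations hC) ≫ ψ).hom (kernelRelation C p) =
        ψ.hom (Finsupp.single p.1 1) := fun p => by
      have hp : kernelRelations hC (kernelRelation C p) =
          elt C a₀ 1 p.2 • (Finsupp.single p.1 1 : KernelCover C a₀) := by
        rw [kernelRelations_kernelRelation, Finsupp.smul_single, smul_eq_mul, mul_one]
      rw [ModuleCat.hom_comp, LinearMap.comp_apply, ModuleCat.hom_ofHom, hp]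
      exact (map_smul ψ.hom _ _).trans (elt_smul_trivialModule _ _ _ _)
    refine funext fun p => ?_
    rw [relationValues_apply, h, h, sub_self, Pi.zero_apply]

/-- `Ext¹` of the augmentation kernel. -/
noncomputable def extOneKernelEquiv (hC : IsNormalizedMatrix C a₀ b₀) :
    Ext (kernelObj C a₀) (trivialModule C) 1 ≃+
      ({a : A // a ≠ a₀} × {b : B // b ≠ b₀} → ℤ) :=
  AddMonoidHom.equivOfSurjectiveOfKer ((kernelCover_shortExact hC).homToExt (trivialModule C))
    (relationValues C a₀ b₀) ((kernelCover_shortExact hC).homToExt_surjective _)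
    (relationValues_surjective hC) (AddEquiv.refl _) fun f =>
      ((kernelCover_shortExact hC).homToExt_eq_zero_iff f).trans
        (relationValues_eq_zero_iff hC f).symm

theorem extOneKernelEquiv_homToExt (hC : IsNormalizedMatrix C a₀ b₀)
    (f : ModuleCat.of (MonoidRing C) (KernelRelations C a₀) ⟶ trivialModule C) :
    extOneKernelEquiv hC ((kernelCover_shortExact hC).homToExt (trivialModule C) f) =
      relationValues C a₀ b₀ f :=
  AddMonoidHom.equivOfSurjectiveOfKer_apply _ _ _ _ _ _ _

end KernelExt

/-! ### The augmentation ideal of `ℤG` and `Hom(G^{ab}, ℤ)`. -/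

section AugmentationIdeal

variable (G) in
/-- The augmentation of the group ring. -/
noncomputable def groupAugmentation :
    MonoidAlgebra ℤ G →ₗ[MonoidAlgebra ℤ G] trivialIntModule G :=
  LinearMap.toSpanSingleton (MonoidAlgebra ℤ G) (trivialIntModule G)
    ((trivialIntModuleEquiv G).symm 1)

theorem groupAugmentation_single (g : G) :
    groupAugmentation G (MonoidAlgebra.single g 1) = (trivialIntModuleEquiv G).symm 1 :=
  single_smul_trivialIntModule _ _

theorem groupAugmentation_surjective : Function.Surjective (groupAugmentation G) := by
  intro x
  refine ⟨trivialIntModuleEquiv G x • MonoidAlgebra.single 1 1, ?_⟩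
  rw [map_zsmul, groupAugmentation_single, ← map_zsmul, smul_eq_mul, mul_one,
    AddEquiv.symm_apply_apply]

variable (G) in
/-- The augmentation ideal of the group ring. -/
noncomputable abbrev augmentationIdeal : Submodule (MonoidAlgebra ℤ G) (MonoidAlgebra ℤ G) :=
  LinearMap.ker (groupAugmentation G)

/-- The element `g - 1` of the augmentation ideal. -/
noncomputable def augmentationIdeal.sub (g : G) : augmentationIdeal G :=
  ⟨MonoidAlgebra.single g 1 - MonoidAlgebra.single 1 1, by
    rw [LinearMap.mem_ker, map_sub, groupAugmentation_single, groupAugmentation_single, sub_self]⟩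

theorem augmentationIdeal.sub_one : augmentationIdeal.sub (1 : G) = 0 :=
  Subtype.ext (sub_self _)

/-- This cocycle identity turns into additivity in any module with trivial action. -/
theorem augmentationIdeal.sub_mul (g h : G) :
    augmentationIdeal.sub (g * h) =
      (MonoidAlgebra.single g 1 : MonoidAlgebra ℤ G) • augmentationIdeal.sub h +
        augmentationIdeal.sub g := by
  refine Subtype.ext ?_
  change (MonoidAlgebra.single (g * h) 1 - MonoidAlgebra.single 1 1 : MonoidAlgebra ℤ G) =
    MonoidAlgebra.single g 1 * (MonoidAlgebra.single h 1 - MonoidAlgebra.single 1 1) +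
      (MonoidAlgebra.single g 1 - MonoidAlgebra.single 1 1)
  rw [mul_sub, MonoidAlgebra.single_mul_single, MonoidAlgebra.single_mul_single, mul_one, mul_one,
    sub_add_sub_cancel]

variable (G) in
/-- The additive retraction onto the augmentation ideal. -/
noncomputable def augmentationIdeal.retraction : MonoidAlgebra ℤ G →+ augmentationIdeal G :=
  MonoidAlgebra.intLiftAddHom augmentationIdeal.sub

/-- The retraction subtracts from `y` its augmentation times `1`. In particular the `g - 1` span the
ideal, which gives the extensionality lemma that follows. -/
theorem augmentationIdeal.retraction_coe (x : augmentationIdeal G) :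
    augmentationIdeal.retraction G x = x := by
  have h : ∀ y : MonoidAlgebra ℤ G, (augmentationIdeal.retraction G y : MonoidAlgebra ℤ G) =
      y - trivialIntModuleEquiv G (groupAugmentation G y) • MonoidAlgebra.single 1 1 := by
    intro y
    refine DFunLike.congr_fun
      (f := (augmentationIdeal G).subtype.toAddMonoidHom.comp (augmentationIdeal.retraction G))
      (g := AddMonoidHom.id _ - ((zmultiplesHom _ (MonoidAlgebra.single 1 1)).comp
        (trivialIntModuleEquiv G).toAddMonoidHom).comp (groupAugmentation G).toAddMonoidHom)
      (MonoidAlgebra.addHom_ext_single_one fun g => ?_) y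
    change ((MonoidAlgebra.intLiftAddHom augmentationIdeal.sub (MonoidAlgebra.single g 1) :
      augmentationIdeal G) : MonoidAlgebra ℤ G) = MonoidAlgebra.single g 1 -
        trivialIntModuleEquiv G (groupAugmentation G (MonoidAlgebra.single g 1)) •
          MonoidAlgebra.single 1 1
    rw [MonoidAlgebra.intLiftAddHom_single, one_smul, groupAugmentation_single,
      AddEquiv.apply_symm_apply, one_smul]
    rfl
  refine Subtype.ext ((h x).trans ?_)
  rw [LinearMap.mem_ker.mp x.2, map_zero, zero_smul, sub_zero]

theorem augmentationIdeal.linearMap_ext {f f' : augmentationIdeal G →ₗ[MonoidAlgebra ℤ G]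
    trivialIntModule G} (h : ∀ g, f (augmentationIdeal.sub g) = f' (augmentationIdeal.sub g)) :
    f = f' := by
  have hff : f.toAddMonoidHom.comp (augmentationIdeal.retraction G) =
      f'.toAddMonoidHom.comp (augmentationIdeal.retraction G) :=
    MonoidAlgebra.addHom_ext_single_one fun g => by
      rw [AddMonoidHom.comp_apply, AddMonoidHom.comp_apply, augmentationIdeal.retraction,
        MonoidAlgebra.intLiftAddHom_single, one_smul]
      exact h g
  refine LinearMap.ext fun x => ?_
  rw [← augmentationIdeal.retraction_coe x]
  exact DFunLike.congr_fun hff _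

/-- The homomorphism on the abelianization attached to a map from the augmentation ideal. -/
noncomputable def augmentationIdeal.toHomAb
    (f : augmentationIdeal G →ₗ[MonoidAlgebra ℤ G] trivialIntModule G) : HomAbInt G :=
  MonoidHom.toAdditiveLeft (Abelianization.lift
    { toFun g := Multiplicative.ofAdd (trivialIntModuleEquiv G (f (augmentationIdeal.sub g)))
      map_one' := by rw [augmentationIdeal.sub_one, map_zero, map_zero, ofAdd_zero]
      map_mul' g h := by
        rw [augmentationIdeal.sub_mul, map_add, map_smul, single_smul_trivialIntModule, map_add,
          ofAdd_add, mul_comm] })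

theorem augmentationIdeal.toHomAb_of
    (f : augmentationIdeal G →ₗ[MonoidAlgebra ℤ G] trivialIntModule G) (g : G) :
    augmentationIdeal.toHomAb f (Additive.ofMul (Abelianization.of g)) =
      trivialIntModuleEquiv G (f (augmentationIdeal.sub g)) := rfl

theorem HomAbInt.ext {H : Type*} [Group H] {f f' : HomAbInt H}
    (h : ∀ g : H, f (Additive.ofMul (Abelianization.of g)) =
      f' (Additive.ofMul (Abelianization.of g))) : f = f' := by
  refine AddMonoidHom.ext fun x => ?_
  obtain ⟨g, hg⟩ := QuotientGroup.mk_surjective x.toMul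
  have : x = Additive.ofMul (Abelianization.of g) := hg.symm
  rw [this, h]

/-- The additive extension to the group ring of a homomorphism to `ℤ`. -/
noncomputable def homAbExtend (F : HomAbInt G) : MonoidAlgebra ℤ G →+ trivialIntModule G :=
  MonoidAlgebra.intLiftAddHom fun g =>
    (trivialIntModuleEquiv G).symm (F (Additive.ofMul (Abelianization.of g)))

theorem homAbExtend_single (F : HomAbInt G) (g : G) :
    homAbExtend F (MonoidAlgebra.single g 1) =
      (trivialIntModuleEquiv G).symm (F (Additive.ofMul (Abelianization.of g))) :=
  (MonoidAlgebra.intLiftAddHom_single _ _ _).trans (one_smul _ _)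

/-- The failure of invariance is a multiple of the augmentation of `x`, so the restriction to the
augmentation ideal is `ℤG`-linear. -/
theorem homAbExtend_single_mul (F : HomAbInt G) (g : G) (x : MonoidAlgebra ℤ G) :
    homAbExtend F (MonoidAlgebra.single g 1 * x) = homAbExtend F x +
      F (Additive.ofMul (Abelianization.of g)) • groupAugmentation G x := by
  induction x using MonoidAlgebra.induction_linear with
  | zero => rw [mul_zero, map_zero, map_zero, smul_zero, add_zero]
  | add x y hx hy => rw [mul_add, map_add, map_add, map_add, hx, hy, smul_add, add_add_add_comm]
  | single h k =>
    rw [MonoidAlgebra.single_eq_zsmul h k, mul_smul_comm, map_zsmul, map_zsmul, map_zsmul,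
      MonoidAlgebra.single_mul_single, one_mul, homAbExtend_single, homAbExtend_single,
      groupAugmentation_single, smul_comm _ k, ← smul_add]
    congr 1
    apply (trivialIntModuleEquiv G).injective
    rw [map_add, map_zsmul, AddEquiv.apply_symm_apply, AddEquiv.apply_symm_apply,
      AddEquiv.apply_symm_apply, map_mul, ofMul_mul, map_add, smul_eq_mul, mul_one, add_comm]

/-- Maps from the augmentation ideal to the trivial module. -/
noncomputable def augmentationIdeal.homEquiv :
    (augmentationIdeal G →ₗ[MonoidAlgebra ℤ G] trivialIntModule G) ≃+ HomAbInt G where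
  toFun := augmentationIdeal.toHomAb
  invFun F := MonoidAlgebra.linearMapOfSingle
    ((homAbExtend F).comp (augmentationIdeal G).subtype.toAddMonoidHom) fun g x => by
      rw [single_smul_trivialIntModule]
      refine (homAbExtend_single_mul F g x).trans ?_
      rw [LinearMap.mem_ker.mp x.2, smul_zero, add_zero]
      rfl
  left_inv f := by
    refine augmentationIdeal.linearMap_ext fun g => ?_
    refine (map_sub (homAbExtend (augmentationIdeal.toHomAb f)) (MonoidAlgebra.single g 1)
      (MonoidAlgebra.single 1 1)).trans ?_
    rw [homAbExtend_single, homAbExtend_single, augmentationIdeal.toHomAb_of,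
      augmentationIdeal.toHomAb_of, augmentationIdeal.sub_one, map_zero, map_zero, map_zero,
      sub_zero, AddEquiv.symm_apply_apply]
  right_inv F := by
    refine HomAbInt.ext fun g => ?_
    refine (congrArg (trivialIntModuleEquiv G) (map_sub (homAbExtend F)
      (MonoidAlgebra.single g 1) (MonoidAlgebra.single 1 1))).trans ?_
    rw [homAbExtend_single, homAbExtend_single, map_sub, AddEquiv.apply_symm_apply,
      AddEquiv.apply_symm_apply, map_one, ofMul_one, map_zero, sub_zero]
  map_add' f f' := by
    refine HomAbInt.ext fun g => ?_
    exact map_add (trivialIntModuleEquiv G) _ _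

end AugmentationIdeal

end ReesMatrix

namespace ReesMatrix

variable {G A B : Type u} [Group G] {C : B → A → G} {a₀ : A} {b₀ : B}

/-! ### `Ext¹(ℤA, ℤ)` and the identification of `Ψ`. -/

section InducedExt

variable (G) in
theorem groupAugmentation_exact :
    Function.Exact (augmentationIdeal G).subtype (groupAugmentation G) :=
  LinearMap.exact_subtype_ker_map _

variable (C) in
/-- The map of induced modules given by the inclusion of the augmentation ideal. -/
noncomputable abbrev inducedIdeal :
    Induced C (augmentationIdeal G) →ₗ[MonoidRing C] Induced C (MonoidAlgebra ℤ G) :=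
  Induced.map C (augmentationIdeal G).subtype

variable (C) in
/-- The map of induced modules given by the augmentation of the group ring. -/
noncomputable abbrev inducedAugmentation :
    Induced C (MonoidAlgebra ℤ G) →ₗ[MonoidRing C] Induced C (trivialIntModule G) :=
  Induced.map C (groupAugmentation G)

variable (C) in
theorem inducedAugmentation_exact : Function.Exact (inducedIdeal C) (inducedAugmentation C) :=
  Induced.map_exact (X := augmentationIdeal G) (groupAugmentation_exact G)

variable (C) in
theorem inducedAugmentation_shortExact :
    (ModuleCat.shortComplexOfExact _ _ (inducedAugmentation_exact C)).ShortExact :=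
  ModuleCat.shortExact_of_exact (Induced.map_injective (Submodule.subtype_injective _))
    (Induced.map_surjective groupAugmentation_surjective) _

/-- Maps from the module induced from the augmentation ideal to the trivial module. -/
noncomputable def inducedIdealHomEquiv (hC : IsNormalizedMatrix C a₀ b₀) :
    (ModuleCat.of (MonoidRing C) (Induced C (augmentationIdeal G)) ⟶ trivialModule C) ≃+
      HomAbInt G :=
  ModuleCat.homAddEquiv.trans
    ((Induced.homTrivialEquiv (augmentationIdeal G) hC).trans augmentationIdeal.homEquiv)

theorem inducedIdealHomEquiv_of (hC : IsNormalizedMatrix C a₀ b₀)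
    (φ : ModuleCat.of (MonoidRing C) (Induced C (augmentationIdeal G)) ⟶ trivialModule C) (g : G) :
    inducedIdealHomEquiv hC φ (Additive.ofMul (Abelianization.of g)) =
      trivialIntModuleEquiv _ (φ.hom (Induced.single C a₀ (augmentationIdeal.sub g))) :=
  (trivialIntModuleEquiv G).apply_symm_apply _

/-- Since `S` acts trivially on `ℤ`, `ψ` takes the same value at every `g` in the copy at `a₀` and
so kills `g - 1`. Hence no nonzero map extends, and `Ext¹` is the whole `Hom` group. -/
theorem inducedIdealHomEquiv_comp (hC : IsNormalizedMatrix C a₀ b₀)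
    (ψ : ModuleCat.of (MonoidRing C) (Induced C (MonoidAlgebra ℤ G)) ⟶ trivialModule C) :
    inducedIdealHomEquiv hC (ModuleCat.ofHom (inducedIdeal C) ≫ ψ) = 0 := by
  refine HomAbInt.ext fun g => ?_
  rw [inducedIdealHomEquiv_of, ModuleCat.hom_comp, LinearMap.comp_apply, ModuleCat.hom_ofHom,
    Induced.map_single]
  have h : Induced.single C a₀ (MonoidAlgebra.single g (1 : ℤ)) =
      elt C a₀ g b₀ • Induced.single C a₀ (MonoidAlgebra.single (1 : G) (1 : ℤ)) := by
    rw [elt_smul_single, hC.row, smul_eq_mul, MonoidAlgebra.single_mul_single, mul_one, mul_one,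
      mul_one]
  have h' : ψ.hom (Induced.single C a₀ (MonoidAlgebra.single g (1 : ℤ))) =
      ψ.hom (Induced.single C a₀ (MonoidAlgebra.single (1 : G) (1 : ℤ))) := by
    rw [h]
    exact (map_smul ψ.hom _ _).trans (elt_smul_trivialModule _ _ _ _)
  have h'' : ψ.hom (Induced.single C a₀ ((augmentationIdeal G).subtype
      (augmentationIdeal.sub g))) = 0 := by
    change ψ.hom (Induced.single C a₀ (MonoidAlgebra.single g 1 - MonoidAlgebra.single 1 1)) = 0
    rw [map_sub (Induced.single C a₀)]
    exact (map_sub ψ.hom _ _).trans (sub_eq_zero.mpr h')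
  rw [h'', map_zero, AddMonoidHom.zero_apply]

/-- `Ext¹` of the induced trivial module. -/
noncomputable def extOneInducedEquiv (hC : IsNormalizedMatrix C a₀ b₀) :
    Ext (ModuleCat.of (MonoidRing C) (Induced C (trivialIntModule G))) (trivialModule C) 1 ≃+
      HomAbInt G :=
  haveI : Projective (ModuleCat.of (MonoidRing C) (Induced C (MonoidAlgebra ℤ G))) :=
    Induced.projective_of _ hC
  AddMonoidHom.equivOfSurjectiveOfKer
    ((inducedAugmentation_shortExact C).homToExt (trivialModule C))
    (inducedIdealHomEquiv hC).toAddMonoidHom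
    ((inducedAugmentation_shortExact C).homToExt_surjective _)
    (inducedIdealHomEquiv hC).surjective (AddEquiv.refl _) fun φ => by
      rw [ShortComplex.ShortExact.homToExt_eq_zero_iff]
      constructor
      · rintro ⟨ψ, rfl⟩
        exact inducedIdealHomEquiv_comp hC ψ
      · intro h
        exact ⟨0, Limits.comp_zero.trans ((inducedIdealHomEquiv hC).map_eq_zero_iff.mp h).symm⟩

theorem extOneInducedEquiv_homToExt (hC : IsNormalizedMatrix C a₀ b₀)
    (φ : ModuleCat.of (MonoidRing C) (Induced C (augmentationIdeal G)) ⟶ trivialModule C) :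
    extOneInducedEquiv hC
      ((inducedAugmentation_shortExact C).homToExt (trivialModule C) φ) =
        inducedIdealHomEquiv hC φ := by
  rw [extOneInducedEquiv]
  exact AddMonoidHom.equivOfSurjectiveOfKer_apply _ _ _ _ _ _ _

/-- The map of presentations over the inclusion of the augmentation kernel in `ℤA`. -/
noncomputable def presentationMap (hC : IsNormalizedMatrix C a₀ b₀) :
    ModuleCat.shortComplexOfExact _ _ (kernelCover_exact hC) ⟶
      ModuleCat.shortComplexOfExact _ _ (inducedAugmentation_exact C) where
  τ₁ := ModuleCat.ofHom (Induced.freeLift hC fun p =>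
    Induced.single C a₀ (augmentationIdeal.sub (C p.2 p.1)))
  τ₂ := ModuleCat.ofHom (Finsupp.linearCombination (MonoidRing C) fun a =>
    Induced.single C (a : A) (MonoidAlgebra.single (1 : G) (1 : ℤ)) -
      Induced.single C a₀ (MonoidAlgebra.single (1 : G) (1 : ℤ)))
  τ₃ := ModuleCat.ofHom (AugmentationKernel.toInduced C a₀)
  comm₁₂ := by
    ext1
    refine Induced.free_linearMap_ext hC fun p => ?_
    refine (congrArg (inducedIdeal C) (Induced.freeLift_single hC _ a₀ p 1)).trans ?_
    refine Eq.trans ?_ (congrArg (Finsupp.linearCombination (MonoidRing C)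
      fun a : {a : A // a ≠ a₀} => Induced.single C (a : A) (MonoidAlgebra.single (1 : G) (1 : ℤ)) -
        Induced.single C a₀ (MonoidAlgebra.single (1 : G) (1 : ℤ)))
      (kernelRelations_single hC a₀ p 1)).symm
    refine Eq.trans ?_ (Finsupp.linearCombination_single _ _ _).symm
    -- Applying `(a₀, 1, b)` to the difference of the generators at `a` and `a₀` gives `C_{ba} -
    -- C_{ba₀}` at `a₀`; the column normalization turns this into `C_{ba} - 1`.
    rw [map_smul, Induced.map_single, elt_smul_single, smul_sub, elt_smul_single, elt_smul_single,
      hC.row, hC.col, one_mul, one_mul, ← MonoidAlgebra.one_def, one_smul, one_smul,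
      smul_eq_mul, mul_one, ← map_sub]
    rfl
  comm₂₃ := by
    ext1
    refine Finsupp.lhom_ext' fun a => LinearMap.ext_ring ?_
    refine (congrArg (inducedAugmentation C) (Finsupp.linearCombination_single _ _ _)).trans ?_
    refine Eq.trans ?_ (congrArg (AugmentationKernel.toInduced C a₀)
      (kernelCover_single a 1)).symm
    rw [one_smul, one_smul, AugmentationKernel.toInduced_single, map_sub, Induced.map_single,
      Induced.map_single, groupAugmentation_single]

theorem presentationMap_comp_relation (hC : IsNormalizedMatrix C a₀ b₀)
    (φ : ModuleCat.of (MonoidRing C) (Induced C (augmentationIdeal G)) ⟶ trivialModule C)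
    (p : {a : A // a ≠ a₀} × B) :
    ((presentationMap hC).τ₁ ≫ φ).hom (kernelRelation C p) =
      φ.hom (Induced.single C a₀ (augmentationIdeal.sub (C p.2 p.1))) := by
  refine (congrArg φ.hom (Induced.freeLift_single hC _ a₀ p 1)).trans ?_
  exact (map_smul φ.hom _ _).trans (elt_smul_trivialModule _ _ _ _)

/-- Restriction to the augmentation kernel corresponds to `Ψ`. -/
theorem extOneKernelEquiv_restrict (hC : IsNormalizedMatrix C a₀ b₀)
    (x : Ext (ModuleCat.of (MonoidRing C) (Induced C (trivialIntModule G))) (trivialModule C) 1) :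
    extOneKernelEquiv hC ((Ext.mk₀ (ModuleCat.ofHom (AugmentationKernel.toInduced C a₀))).comp x
      (zero_add 1)) = reesPsi C a₀ b₀ (extOneInducedEquiv hC x) := by
  have : Projective (ModuleCat.of (MonoidRing C) (Induced C (MonoidAlgebra ℤ G))) :=
    Induced.projective_of _ hC
  obtain ⟨φ, rfl⟩ := (inducedAugmentation_shortExact C).homToExt_surjective (trivialModule C) x
  rw [extOneInducedEquiv_homToExt]
  refine (congrArg (extOneKernelEquiv hC) ((kernelCover_shortExact hC).homToExt_naturality
    (inducedAugmentation_shortExact C) (presentationMap hC) φ).symm).trans ?_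
  refine (extOneKernelEquiv_homToExt hC _).trans (funext fun p => ?_)
  -- The normalizing term involves `C_{b₀a} - 1 = 0`, so only the value at `C_{ba} - 1` remains.
  rw [relationValues_apply, presentationMap_comp_relation, presentationMap_comp_relation, hC.row,
    augmentationIdeal.sub_one, map_zero (Induced.single C a₀)]
  have h : φ.hom (0 : Induced C (augmentationIdeal G)) = 0 := map_zero φ.hom
  rw [h, map_zero, sub_zero, ← inducedIdealHomEquiv_of hC]
  rfl

end InducedExt

/-! ### The long exact sequence and the cohomology of `S`. -/

section Cohomology

/-- The map `Hⁿ(S) → Extⁿ(ℤA, ℤ)`. -/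
noncomputable def toExtInduced (hC : IsNormalizedMatrix C a₀ b₀) (n : ℕ) :
    semigroupCohomology (ReesMatrix C) n →+
      Ext (ModuleCat.of (MonoidRing C) (Induced C (trivialIntModule G))) (trivialModule C) n :=
  (Ext.mk₀ (ModuleCat.ofHom (augmentation hC))).precomp (trivialModule C) (zero_add n)

theorem toExtInduced_injective (hC : IsNormalizedMatrix C a₀ b₀) {n : ℕ}
    (h : Subsingleton (Ext (kernelObj C a₀) (trivialModule C) n)) :
    Function.Injective (toExtInduced hC (n + 1)) := by
  rw [injective_iff_map_eq_zero]
  intro x hx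
  obtain ⟨y, rfl⟩ := Ext.contravariant_sequence_exact₃ (augmentation_shortExact hC) _ x hx
    (add_comm 1 n)
  rw [h.elim y 0, Ext.comp_zero]

theorem toExtInduced_surjective (hC : IsNormalizedMatrix C a₀ b₀) {n : ℕ}
    (h : Subsingleton (Ext (kernelObj C a₀) (trivialModule C) n)) :
    Function.Surjective (toExtInduced hC n) := fun x =>
  Ext.contravariant_sequence_exact₂ (augmentation_shortExact hC) _ x (h.elim _ _)

theorem nonempty_semigroupCohomology_zero_equiv :
    Nonempty (semigroupCohomology (ReesMatrix C) 0 ≃+ ℤ) :=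
  ⟨Ext.addEquiv₀.trans (ModuleCat.homAddEquiv.trans (trivialIntModuleEnd _))⟩

/-- Exactness at `Ext¹(ℤA, ℤ)`, with restriction to `K` rewritten as `Ψ`. -/
theorem reesPsi_extOneInducedEquiv_eq_zero_iff (hC : IsNormalizedMatrix C a₀ b₀)
    (x : Ext (ModuleCat.of (MonoidRing C) (Induced C (trivialIntModule G))) (trivialModule C) 1) :
    reesPsi C a₀ b₀ (extOneInducedEquiv hC x) = 0 ↔ ∃ y, toExtInduced hC 1 y = x := by
  rw [← extOneKernelEquiv_restrict, AddEquiv.map_eq_zero_iff]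
  constructor
  · exact Ext.contravariant_sequence_exact₂ (augmentation_shortExact hC) _ x
  · rintro ⟨y, rfl⟩
    have h := congrArg (fun f => (Ext.mk₀ f).comp y (zero_add 1))
      (ModuleCat.shortComplexOfExact _ _ (augmentation_exact hC)).zero
    rw [Ext.mk₀_zero, Ext.zero_comp] at h
    exact (Ext.mk₀_comp_mk₀_assoc _ _ _).trans h

theorem nonempty_semigroupCohomology_one_equiv (hC : IsNormalizedMatrix C a₀ b₀) :
    Nonempty (semigroupCohomology (ReesMatrix C) 1 ≃+ (reesPsi C a₀ b₀).ker) := by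
  refine ⟨AddEquiv.ofBijective (((extOneInducedEquiv hC).toAddMonoidHom.comp
    (toExtInduced hC 1)).codRestrict (reesPsi C a₀ b₀).ker fun y =>
      (reesPsi_extOneInducedEquiv_eq_zero_iff hC _).mpr ⟨y, rfl⟩) ⟨?_, ?_⟩⟩
  · intro x y hxy
    exact toExtInduced_injective hC (subsingleton_ext_kernel_zero b₀)
      ((extOneInducedEquiv hC).injective (congrArg Subtype.val hxy))
  · rintro ⟨f, hf⟩
    obtain ⟨x, rfl⟩ := (extOneInducedEquiv hC).surjective f
    obtain ⟨y, rfl⟩ := (reesPsi_extOneInducedEquiv_eq_zero_iff hC x).mp hf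
    exact ⟨y, rfl⟩

theorem nonempty_semigroupCohomology_equiv (hC : IsNormalizedMatrix C a₀ b₀) {n : ℕ} (hn : 3 ≤ n) :
    Nonempty (semigroupCohomology (ReesMatrix C) n ≃+ monoidCohomology G n) := by
  obtain ⟨n, rfl⟩ := Nat.exists_eq_add_of_le' hn
  obtain ⟨e⟩ := nonempty_ext_induced_equiv hC (n + 2) (trivialIntModule G)
  -- Injectivity uses `Ext` of `K` one degree lower, surjectivity in the same degree; both degrees
  -- are at least two, which is why `n ≥ 3` is needed.
  exact ⟨(AddEquiv.ofBijective (toExtInduced hC (n + 3))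
    ⟨toExtInduced_injective hC (subsingleton_ext_kernel_add_two hC n),
      toExtInduced_surjective hC (subsingleton_ext_kernel_add_two hC (n + 1))⟩).trans e⟩

/-- The connecting map `ℤ^{Ā × B̄} → H²(S)`. -/
noncomputable def connectingHom (hC : IsNormalizedMatrix C a₀ b₀) :
    ({a : A // a ≠ a₀} × {b : B // b ≠ b₀} → ℤ) →+ semigroupCohomology (ReesMatrix C) 2 :=
  ((augmentation_shortExact hC).extClass.precomp (trivialModule C) one_add_one_eq_two).comp
    (extOneKernelEquiv hC).symm.toAddMonoidHom

theorem connectingHom_ker (hC : IsNormalizedMatrix C a₀ b₀) :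
    (connectingHom hC).ker = (reesPsi C a₀ b₀).range := by
  ext v
  constructor
  · intro hv
    obtain ⟨y, hy⟩ := Ext.contravariant_sequence_exact₁ (augmentation_shortExact hC) _
      ((extOneKernelEquiv hC).symm v) one_add_one_eq_two hv
    refine ⟨extOneInducedEquiv hC y, ?_⟩
    rw [← extOneKernelEquiv_restrict]
    exact (congrArg (extOneKernelEquiv hC) hy).trans ((extOneKernelEquiv hC).apply_symm_apply v)
  · rintro ⟨f, rfl⟩
    obtain ⟨x, rfl⟩ := (extOneInducedEquiv hC).surjective f
    rw [← extOneKernelEquiv_restrict, AddMonoidHom.mem_ker]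
    refine (congrArg ((augmentation_shortExact hC).extClass.precomp (trivialModule C)
      one_add_one_eq_two) ((extOneKernelEquiv hC).symm_apply_apply _)).trans ?_
    exact (augmentation_shortExact hC).extClass_comp_assoc x (h := one_add_one_eq_two)

theorem connectingHom_exact (hC : IsNormalizedMatrix C a₀ b₀) :
    Function.Exact (connectingHom hC) (toExtInduced hC 2) := by
  intro x
  constructor
  · intro hx
    obtain ⟨y, hy⟩ := Ext.contravariant_sequence_exact₃ (augmentation_shortExact hC) _ x hx
      one_add_one_eq_two
    refine ⟨extOneKernelEquiv hC y, ?_⟩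
    exact (congrArg ((augmentation_shortExact hC).extClass.precomp (trivialModule C)
      one_add_one_eq_two) ((extOneKernelEquiv hC).symm_apply_apply y)).trans hy
  · rintro ⟨v, rfl⟩
    exact (augmentation_shortExact hC).comp_extClass_assoc _ one_add_one_eq_two

/-- Surjectivity onto `H²(G)` comes from `Ext²(K, ℤ) = 0`. -/
theorem exists_connectingHom_exact (hC : IsNormalizedMatrix C a₀ b₀) :
    ∃ p : semigroupCohomology (ReesMatrix C) 2 →+ monoidCohomology G 2,
      Function.Exact (connectingHom hC) p ∧ Function.Surjective p := by
  obtain ⟨e⟩ := nonempty_ext_induced_equiv hC 1 (trivialIntModule G)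
  refine ⟨e.toAddMonoidHom.comp (toExtInduced hC 2), fun x => ?_, e.surjective.comp
    (toExtInduced_surjective hC (subsingleton_ext_kernel_add_two hC 0))⟩
  exact e.map_eq_zero_iff.trans (connectingHom_exact hC x)

end Cohomology

/-! ### The group completion and `ker Ψ`. -/

section GroupCompletion

theorem _root_.GroupCompletion.homAbInt_ext {M : Type*} [Monoid M]
    {f f' : HomAbInt (GroupCompletion M)}
    (h : ∀ m, f (Additive.ofMul (Abelianization.of (GroupCompletion.ofHom M m))) =
      f' (Additive.ofMul (Abelianization.of (GroupCompletion.ofHom M m)))) : f = f' := by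
  have hff : (AddMonoidHom.toMultiplicativeRight f).comp Abelianization.of =
      (AddMonoidHom.toMultiplicativeRight f').comp Abelianization.of :=
    (GroupCompletion.existsUnique_lift
      (((AddMonoidHom.toMultiplicativeRight f).comp Abelianization.of).comp
        (GroupCompletion.ofHom M))).unique rfl
      (MonoidHom.ext fun m => congrArg Multiplicative.ofAdd (h m).symm)
  exact HomAbInt.ext fun g => congrArg Multiplicative.toAdd (DFunLike.congr_fun hff g)

variable (C) in
/-- The value of `f` on the class of `(a, g, b)`. -/
def completionValue (f : HomAbInt (GroupCompletion (WithOne (ReesMatrix C)))) (a : A) (g : G)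
    (b : B) : ℤ :=
  f (Additive.ofMul (Abelianization.of (GroupCompletion.ofHom _
    ((⟨a, g, b⟩ : ReesMatrix C) : WithOne (ReesMatrix C)))))

variable (f : HomAbInt (GroupCompletion (WithOne (ReesMatrix C))))

theorem completionValue_mul (a a' : A) (g g' : G) (b b' : B) :
    completionValue C f a (g * C b a' * g') b' =
      completionValue C f a g b + completionValue C f a' g' b' := by
  simp only [completionValue]
  rw [← map_add, ← ofMul_mul, ← map_mul, ← map_mul, ← WithOne.coe_mul, mul_def]

/-- An idempotent has value `0` under any homomorphism to `ℤ`. -/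
theorem completionValue_one (hC : IsNormalizedMatrix C a₀ b₀) :
    completionValue C f a₀ 1 b₀ = 0 := by
  have h := completionValue_mul f a₀ a₀ 1 1 b₀ b₀
  rw [hC.row, mul_one, mul_one] at h
  omega

theorem completionValue_left (hC : IsNormalizedMatrix C a₀ b₀) (a : A) :
    completionValue C f a 1 b₀ = 0 := by
  have h := completionValue_mul f a₀ a 1 1 b₀ b₀
  rw [hC.row, mul_one, mul_one, completionValue_one f hC] at h
  omega

theorem completionValue_right (hC : IsNormalizedMatrix C a₀ b₀) (b : B) :
    completionValue C f a₀ 1 b = 0 := by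
  have h := completionValue_mul f a₀ a₀ 1 1 b b₀
  rw [hC.col, mul_one, mul_one, completionValue_one f hC] at h
  omega

/-- Factor `(a, g, b) = (a, 1, b₀)(a₀, g, b₀)(a₀, 1, b)`; the outer factors have value `0`. -/
theorem completionValue_eq (hC : IsNormalizedMatrix C a₀ b₀) (a : A) (g : G) (b : B) :
    completionValue C f a g b = completionValue C f a₀ g b₀ := by
  have h := completionValue_mul f a a₀ 1 g b₀ b₀
  have h' := completionValue_mul f a a₀ g 1 b₀ b
  rw [hC.row, one_mul, one_mul, completionValue_left f hC] at h
  rw [hC.row, mul_one, mul_one, completionValue_right f hC] at h'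
  omega

/-- The product `(a₀, 1, b)(a, 1, b₀) = (a₀, C_{ba}, b₀)` has two factors of value `0`. This puts
the restrictions inside `ker Ψ`. -/
theorem completionValue_entry (hC : IsNormalizedMatrix C a₀ b₀) (a : A) (b : B) :
    completionValue C f a₀ (C b a) b₀ = 0 := by
  have h := completionValue_mul f a₀ a 1 1 b b₀
  rwa [one_mul, mul_one, completionValue_left f hC, completionValue_right f hC] at h

theorem restrict_toGroupCompletion_of (hC : IsNormalizedMatrix C a₀ b₀) (g : G) :
    HomAbInt.restrict (toGroupCompletion hC) f (Additive.ofMul (Abelianization.of g)) =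
      completionValue C f a₀ g b₀ := rfl

theorem restrict_toGroupCompletion_injective (hC : IsNormalizedMatrix C a₀ b₀) :
    Function.Injective (HomAbInt.restrict (toGroupCompletion hC)) := by
  intro f f' h
  refine GroupCompletion.homAbInt_ext fun m => ?_
  refine WithOne.cases_on m (by simp only [map_one, ofMul_one, map_zero]) fun s => ?_
  change completionValue C f s.left s.mid s.right = completionValue C f' s.left s.mid s.right
  rw [completionValue_eq f hC, completionValue_eq f' hC, ← restrict_toGroupCompletion_of f hC, h]
  rfl

theorem apply_entry_of_mem_ker (hC : IsNormalizedMatrix C a₀ b₀) {φ : HomAbInt G}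
    (hφ : φ ∈ (reesPsi C a₀ b₀).ker) (a : A) (b : B) :
    φ (Additive.ofMul (Abelianization.of (C b a))) = 0 := by
  by_cases ha : a = a₀
  · rw [ha, hC.col, map_one, ofMul_one, map_zero]
  by_cases hb : b = b₀
  · rw [hb, hC.row, map_one, ofMul_one, map_zero]
  exact congrFun hφ (⟨a, ha⟩, ⟨b, hb⟩)

theorem restrict_toGroupCompletion_range (hC : IsNormalizedMatrix C a₀ b₀) :
    (HomAbInt.restrict (toGroupCompletion hC)).range = (reesPsi C a₀ b₀).ker := by
  ext φ
  constructor
  · rintro ⟨f, rfl⟩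
    exact funext fun p => completionValue_entry f hC p.1 p.2
  · intro hφ
    -- Forgetting `a` and `b`, the map `(a, g, b) ↦ φ(g)` is multiplicative because `φ` vanishes on
    -- all entries of `C`.
    let F : WithOne (ReesMatrix C) →* Multiplicative ℤ := WithOne.lift
      { toFun s := Multiplicative.ofAdd (φ (Additive.ofMul (Abelianization.of s.mid)))
        map_mul' s t := by
          rw [mul_def, ← ofAdd_add, map_mul Abelianization.of, map_mul Abelianization.of,
            ofMul_mul, ofMul_mul, map_add φ, map_add φ,
            apply_entry_of_mem_ker hC hφ, add_zero] }
    obtain ⟨F', hF', -⟩ := GroupCompletion.existsUnique_lift F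
    refine ⟨MonoidHom.toAdditiveLeft (Abelianization.lift F'), HomAbInt.ext fun g => ?_⟩
    exact congrArg Multiplicative.toAdd (DFunLike.congr_fun hF'
      ((⟨a₀, g, b₀⟩ : ReesMatrix C) : WithOne (ReesMatrix C)))

end GroupCompletion

/-! ### The finite case and the assembly. -/

theorem reesPsi_eq_zero_of_finite
    (h : Finite (Subgroup.closure (Set.range fun p : {a : A // a ≠ a₀} × {b : B // b ≠ b₀} =>
      Abelianization.of (C p.2 p.1)))) : reesPsi C a₀ b₀ = 0 := by
  ext f p
  let x : Subgroup.closure (Set.range fun p : {a : A // a ≠ a₀} × {b : B // b ≠ b₀} =>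
      Abelianization.of (C p.2 p.1)) := ⟨_, Subgroup.subset_closure ⟨p, rfl⟩⟩
  -- Each entry has finite order in `G^{ab}`, and `ℤ` is torsion-free.
  obtain ⟨n, hn, hx⟩ := isOfFinOrder_iff_pow_eq_one.mp (isOfFinOrder_of_finite x)
  have hx' : (Abelianization.of (C p.2 p.1)) ^ n = 1 := congrArg Subtype.val hx
  have hf : n • f (Additive.ofMul (Abelianization.of (C p.2 p.1))) = 0 := by
    rw [← map_nsmul, ← ofMul_pow, hx', ofMul_one, map_zero]
  exact (smul_eq_zero.mp hf).resolve_left hn.ne'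

end ReesMatrix

theorem mainTheorem5 {G A B : Type u} [Group G] (C : B → A → G) (a₀ : A) (b₀ : B)
    (hC : IsNormalizedMatrix C a₀ b₀) :
    Nonempty (semigroupCohomology (ReesMatrix C) 0 ≃+ ℤ) ∧
    Nonempty (semigroupCohomology (ReesMatrix C) 1 ≃+ (reesPsi C a₀ b₀).ker) ∧
    -- `ker Ψ` is `Hom(G(M)^{ab}, ℤ)`, embedded by restriction along `G → G(M)`
    (Function.Injective (HomAbInt.restrict (toGroupCompletion hC)) ∧
      (HomAbInt.restrict (toGroupCompletion hC)).range = (reesPsi C a₀ b₀).ker) ∧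
    (∀ n : ℕ, 3 ≤ n →
      Nonempty (semigroupCohomology (ReesMatrix C) n ≃+ monoidCohomology G n)) ∧
    -- the exact sequence `0 → coker Ψ → H²(M) → H²(G) → 0`
    (∃ (i : (({a : A // a ≠ a₀} × {b : B // b ≠ b₀} → ℤ) ⧸ (reesPsi C a₀ b₀).range) →+
          semigroupCohomology (ReesMatrix C) 2)
        (p : semigroupCohomology (ReesMatrix C) 2 →+ monoidCohomology G 2),
      Function.Injective i ∧ Function.Exact i p ∧ Function.Surjective p) ∧
    -- the case in which the `C_{ba}[G, G]` generate a finite subgroup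
    (Finite (Subgroup.closure (Set.range fun p : {a : A // a ≠ a₀} × {b : B // b ≠ b₀} =>
        Abelianization.of (C p.2 p.1))) →
      reesPsi C a₀ b₀ = 0 ∧
      Nonempty (semigroupCohomology (ReesMatrix C) 1 ≃+ HomAbInt G) ∧
      ∃ (i : ({a : A // a ≠ a₀} × {b : B // b ≠ b₀} → ℤ) →+
            semigroupCohomology (ReesMatrix C) 2)
          (p : semigroupCohomology (ReesMatrix C) 2 →+ monoidCohomology G 2),
        Function.Injective i ∧ Function.Exact i p ∧ Function.Surjective p) := by
  obtain ⟨p, hp, hp'⟩ := ReesMatrix.exists_connectingHom_exact hC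
  have hker := ReesMatrix.connectingHom_ker hC
  refine ⟨ReesMatrix.nonempty_semigroupCohomology_zero_equiv,
    ReesMatrix.nonempty_semigroupCohomology_one_equiv hC,
    ⟨ReesMatrix.restrict_toGroupCompletion_injective hC,
      ReesMatrix.restrict_toGroupCompletion_range hC⟩,
    fun n hn => ReesMatrix.nonempty_semigroupCohomology_equiv hC hn,
    -- The connecting map has kernel exactly the range of `Ψ`, so it descends to an injection of the
    -- cokernel with the same image.
    ⟨QuotientAddGroup.lift (reesPsi C a₀ b₀).range (ReesMatrix.connectingHom hC) hker.ge, p,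
      ?_, ?_, hp'⟩, fun h => ?_⟩
  · refine (injective_iff_map_eq_zero
      (QuotientAddGroup.lift (reesPsi C a₀ b₀).range (ReesMatrix.connectingHom hC)
        hker.ge)).mpr fun v hv => ?_
    obtain ⟨v, rfl⟩ := QuotientAddGroup.mk_surjective v
    exact (QuotientAddGroup.eq_zero_iff v).mpr (hker.le hv)
  · intro x
    rw [hp x]
    constructor
    · rintro ⟨v, rfl⟩
      exact ⟨QuotientAddGroup.mk v, rfl⟩
    · rintro ⟨v, rfl⟩
      obtain ⟨v, rfl⟩ := QuotientAddGroup.mk_surjective v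
      exact ⟨v, rfl⟩
  · have h0 := ReesMatrix.reesPsi_eq_zero_of_finite h
    obtain ⟨e⟩ := ReesMatrix.nonempty_semigroupCohomology_one_equiv hC
    refine ⟨h0, ⟨e.trans ((AddEquiv.addSubgroupCongr (by rw [h0, AddMonoidHom.ker_zero])).trans
      AddSubgroup.topEquiv)⟩, ReesMatrix.connectingHom hC, p, ?_, hp, hp'⟩
    rw [← AddMonoidHom.ker_eq_bot_iff, hker, h0]
    ext v
    simp
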